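/- A matching instance $I=(P,Q,E,\succ)$ consists of a finite set $P$ of firms, a finite set $Q$ of workers, a set $E\subseteq P\times Q$ of acceptable pairs, and for every $r\in P\cup Q$ a strict linear order $\succ_r$ on the acceptable partners of $r$; being unmatched is worse than every acceptable partner. An offering order $\sigma$ is a linear order on $E$ that is consistent with the firms' preferences: if $(p,q),(p,q')\in E$ and $q\succ_p q'$, then $(p,q)$ precedes $(p,q')$. In the sequential matching game $(I,\sigma)$ the offers are made in the order $\sigma$. When $p$ makes an offer to $q$, the worker $q$ either accepts (then $p$ and $q$ are matched irrevocably and all other offers involving $p$ or $q$ are removed) or rejects (then only the offer $(p,q)$ is removed). The workers are the players of this perfect-information game, and each cares only about her own assignment. An SPE matching is the outcome of a subgame perfect equilibrium. For a matching instance $\hat I$, let $\mathrm{QOPT}(\hat I)$ be its worker-optimal stable matching: the stable matching that every worker weakly prefers to every stable matching. Run the worker-proposing deferred acceptance algorithm on $\hat I$ in rounds (in each round every unmatched worker proposes to her best firm that has not rejected her, if there is one; then every firm keeps its best proposer and rejects the others), and let $\alpha(\hat I)$ be the set of firms $p$ matched in $\mathrm{QOPT}(\hat I)$ that accept the proposal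 of their partner in $\mathrm{QOPT}(\hat I)$ in the earliest round among all such firms. For $e=(p,q)$ let $\hat I/e$ be the instance in which $p$ and $q$ are removed. Theorem. Every matching instance $I$ has a worker-optimal stable matching $\mu=\mathrm{QOPT}(I)$. Let $F$ be the set of all $(p,q)\in E$ such that $p$ prefers $q$ to its assignment in $\mu$ (every $(p,q)\in E$ if $p$ is unmatched in $\mu$), let $I'$ be $I$ with the pairs of $F$ deleted, and let $k=|\mathrm{QOPT}(I')|$. There is an offering order $\sigma$ such that 1. $\sigma$ is consistent with the firms' preferences; 2. the offers in $F$ come before all the other offers; 3. the offers in $E\setminus F$ are ordered according to a linear order $p_1,p_2,\dots,p_{|P|}$ of all firms (all offers of $p_i$ in $E\setminus F$ precede all offers of $p_j$ in $E\setminus F$ if $i<j$), where with $I_0=I'$ it holds for $i=1,\dots,k$ that $p_i\in\alpha(I_{i-1})$ and $I_i=I_{i-1}/(p_i,q_i)$, with $q_i$ the partner of $p_i$ in $\mathrm{QOPT}(I_{i-1})$. For every offering order $\sigma$ that satisfies 1, 2 and 3, the game $(I,\sigma)$ has a subgame perfect equilibrium, and the outcome of each of its subgame perfect equilibria is $\mathrm{QOPT}(I)$.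 In particular, for every matching instance $I$ there is a consistent offering order whose SPE matching is the worker-optimal stable matching. -/

import Mathlib

/-- A matching instance `(P, Q, E, ≻)` with firms `P`, workers `Q`, acceptable pairs `E`, and for
every firm `p` (resp. worker `q`) a strict linear order on its acceptable partners.
`firmPref p q q'` means `q ≻_p q'`, and `workerPref q p p'` means `p ≻_q p'`; only the restrictions
of these relations to acceptable partners are meaningful. -/
structure MatchingInstance (P Q : Type*) where
  E : Set (P × Q)
  firmPref : P → Q → Q → Prop
  workerPref : Q → P → P → Prop
  firm_irrefl : ∀ p q, (p, q) ∈ E → ¬ firmPref p q q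
  firm_trans : ∀ p q₁ q₂ q₃, (p, q₁) ∈ E → (p, q₂) ∈ E → (p, q₃) ∈ E →
    firmPref p q₁ q₂ → firmPref p q₂ q₃ → firmPref p q₁ q₃
  firm_total : ∀ p q₁ q₂, (p, q₁) ∈ E → (p, q₂) ∈ E →
    firmPref p q₁ q₂ ∨ q₁ = q₂ ∨ firmPref p q₂ q₁
  worker_irrefl : ∀ q p, (p, q) ∈ E → ¬ workerPref q p p
  worker_trans : ∀ q p₁ p₂ p₃, (p₁, q) ∈ E → (p₂, q) ∈ E → (p₃, q) ∈ E →
    workerPref q p₁ p₂ → workerPref q p₂ p₃ → workerPref q p₁ p₃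
  worker_total : ∀ q p₁ p₂, (p₁, q) ∈ E → (p₂, q) ∈ E →
    workerPref q p₁ p₂ ∨ p₁ = p₂ ∨ workerPref q p₂ p₁

namespace MatchingInstance

variable {P Q : Type*}

/-! ### Sub-instances -/

/-- The instance with acceptable pairs `E'` and the inherited preferences. -/
def restrict (I : MatchingInstance P Q) (E' : Set (P × Q)) (h : E' ⊆ I.E) :
    MatchingInstance P Q where
  E := E'
  firmPref := I.firmPref
  workerPref := I.workerPref
  firm_irrefl p q hq := I.firm_irrefl p q (h hq)
  firm_trans p q₁ q₂ q₃ h₁ h₂ h₃ := I.firm_trans p q₁ q₂ q₃ (h h₁) (h h₂) (h h₃)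
  firm_total p q₁ q₂ h₁ h₂ := I.firm_total p q₁ q₂ (h h₁) (h h₂)
  worker_irrefl q p hp := I.worker_irrefl q p (h hp)
  worker_trans q p₁ p₂ p₃ h₁ h₂ h₃ := I.worker_trans q p₁ p₂ p₃ (h h₁) (h h₂) (h h₃)
  worker_total q p₁ p₂ h₁ h₂ := I.worker_total q p₁ p₂ (h h₁) (h h₂)

/-- The deletion of all pairs of `D`. -/
def delete (I : MatchingInstance P Q) (D : Set (P × Q)) : MatchingInstance P Q :=
  I.restrict (I.E \ D) (fun _ he => he.1)

/-- The contraction `I / e`: the firm and the worker of `e` leave the market. They are kept as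
members of the types `P` and `Q`, but without any acceptable partner. -/
def contract (I : MatchingInstance P Q) (e : P × Q) : MatchingInstance P Q :=
  I.restrict {e' ∈ I.E | e'.1 ≠ e.1 ∧ e'.2 ≠ e.2} (fun _ he => he.1)

/-! ### Matchings and stability

A matching is identified with its set of matched pairs; `μ(p) = q` and `μ(q) = p` are both
expressed by `(p, q) ∈ μ`. -/

/-- `μ` is a matching in `I`. -/
def IsMatching (I : MatchingInstance P Q) (μ : Set (P × Q)) : Prop :=
  μ ⊆ I.E ∧ (∀ p q q', (p, q) ∈ μ → (p, q') ∈ μ → q = q') ∧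
    (∀ q p p', (p, q) ∈ μ → (p', q) ∈ μ → p = p')

/-- `q ≻_p μ(p)`, for an acceptable pair `(p, q)`; true if `p` is unmatched in `μ`. -/
def FirmPrefersTo (I : MatchingInstance P Q) (μ : Set (P × Q)) (p : P) (q : Q) : Prop :=
  ∀ q', (p, q') ∈ μ → I.firmPref p q q'

/-- `p ≻_q μ(q)`, for an acceptable pair `(p, q)`; true if `q` is unmatched in `μ`. -/
def WorkerPrefersTo (I : MatchingInstance P Q) (μ : Set (P × Q)) (q : Q) (p : P) : Prop :=
  ∀ p', (p', q) ∈ μ → I.workerPref q p p'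

/-- `μ₁(q) ⪰_q μ₂(q)`, where being unmatched is at the bottom of the preference of `q`. -/
def WorkerWeaklyPrefers (I : MatchingInstance P Q) (q : Q) (μ₁ μ₂ : Set (P × Q)) : Prop :=
  ∀ p₂, (p₂, q) ∈ μ₂ → ∃ p₁, (p₁, q) ∈ μ₁ ∧ (p₁ = p₂ ∨ I.workerPref q p₁ p₂)

/-- The acceptable pair `(p, q)` blocks `μ`. -/
def Blocks (I : MatchingInstance P Q) (μ : Set (P × Q)) (p : P) (q : Q) : Prop :=
  (p, q) ∈ I.E ∧ I.FirmPrefersTo μ p q ∧ I.WorkerPrefersTo μ q p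

/-- `μ` is a stable matching in `I`. -/
def IsStable (I : MatchingInstance P Q) (μ : Set (P × Q)) : Prop :=
  I.IsMatching μ ∧ ∀ p q, ¬ I.Blocks μ p q

/-- `μ` is the worker-optimal stable matching of `I`. -/
def IsWorkerOptimal (I : MatchingInstance P Q) (μ : Set (P × Q)) : Prop :=
  I.IsStable μ ∧ ∀ μ', I.IsStable μ' → ∀ q, I.WorkerWeaklyPrefers q μ μ'

/-! ### The worker-proposing deferred acceptance algorithm -/

/-- A state of the algorithm between two iterations of the main loop: the acceptable pairs that
have not been rejected yet, and the pairs that are currently (tentatively) matched. -/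
structure DAState (P Q : Type*) where
  remaining : Set (P × Q)
  held : Set (P × Q)

/-- The pairs `(p, q)` such that `p` has a standing proposal of `q` after the proposal phase of an
iteration: those held before, and, for every worker `q` that is currently unmatched, the pair of
`q` with her most preferred remaining firm, if any. -/
def proposals (I : MatchingInstance P Q) (S : DAState P Q) : Set (P × Q) :=
  S.held ∪ {e | (∀ p, (p, e.2) ∉ S.held) ∧ e ∈ S.remaining ∧
    ∀ p, (p, e.2) ∈ S.remaining → p = e.1 ∨ I.workerPref e.2 e.1 p}

/-- The standing proposals that are kept in an iteration: every firm keeps its most preferred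
proposer. -/
def kept (I : MatchingInstance P Q) (S : DAState P Q) : Set (P × Q) :=
  {e ∈ I.proposals S | ∀ q, (e.1, q) ∈ I.proposals S → q = e.2 ∨ I.firmPref e.1 e.2 q}

/-- One iteration of the main loop; the proposals that are not kept are irrevocably rejected.
When no worker makes a new proposal, the state does not change any more. -/
def daStep (I : MatchingInstance P Q) (S : DAState P Q) : DAState P Q where
  remaining := S.remaining \ (I.proposals S \ I.kept S)
  held := I.kept S

/-- The state after `t` iterations. -/
def daState (I : MatchingInstance P Q) : ℕ → DAState P Q
  | 0 => ⟨I.E, ∅⟩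
  | t + 1 => I.daStep (I.daState t)

/-- `p` accepts the proposal of `q` in iteration `t`. -/
def AcceptsAt (I : MatchingInstance P Q) (p : P) (q : Q) (t : ℕ) : Prop :=
  (p, q) ∈ (I.daState t).held ∧ ∀ t' < t, (p, q) ∉ (I.daState t').held

/-- `(p, q)` is a pair of the worker-optimal stable matching of `I`, and among all the pairs of
this matching it is one that is accepted in the earliest iteration of the algorithm. -/
def IsEarliestPair (I : MatchingInstance P Q) (p : P) (q : Q) : Prop :=
  ∃ μ, I.IsWorkerOptimal μ ∧ (p, q) ∈ μ ∧
    ∃ t, I.AcceptsAt p q t ∧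
      ∀ p' q' t', (p', q') ∈ μ → I.AcceptsAt p' q' t' → t ≤ t'

/-! ### Offering orders

An order on a finite set is given as the duplicate-free list of its elements. -/

/-- `σ` is an offering order over `E` consistent with the preferences of the firms: of two offers
by the same firm, the one to the preferred worker comes first. -/
def IsOfferingOrder (I : MatchingInstance P Q) (σ : List (P × Q)) : Prop :=
  σ.Nodup ∧ (∀ e, e ∈ σ ↔ e ∈ I.E) ∧
    σ.Pairwise (fun e e' => e.1 = e'.1 → I.firmPref e.1 e.2 e'.2)

/-! ### The sequential matching game -/

/-- The two possible answers to an offer. -/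
inductive Action where
  | accept : Action
  | reject : Action

section Game

variable [DecidableEq P] [DecidableEq Q]

/-- The offers of a list that involve neither the firm nor the worker of `e`. -/
def contractOrder (σ : List (P × Q)) (e : P × Q) : List (P × Q) :=
  σ.filter (fun e' => e'.1 ≠ e.1 ∧ e'.2 ≠ e.2)

/-- The offers that remain, in their order, after a history of answers (in chronological order) in
the game with the offering order given. -/
def subgame : List (P × Q) → List Action → List (P × Q)
  | σ, [] => σ
  | [], _ :: _ => []
  | e :: σ, Action.accept :: h => subgame (contractOrder σ e) h
  | _ :: σ, Action.reject :: h => subgame σ h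

/-- `q` is the player who moves after the history `h`, i.e. the receiver of the next offer. -/
def Moves (σ : List (P × Q)) (h : List Action) (q : Q) : Prop :=
  ∃ e, (subgame σ h).head? = some e ∧ e.2 = q

/-- The outcome of the game under a strategy profile. A profile assigns an answer to every
history; the strategy of a worker is its restriction to the histories after which she moves. -/
def outcome (s : List Action → Action) : List (P × Q) → Set (P × Q)
  | [] => ∅
  | e :: σ =>
    match s [] with
    | Action.accept => insert e (outcome (fun h => s (Action.accept :: h)) (contractOrder σ e))
    | Action.reject => outcome (fun h => s (Action.reject :: h)) σ
termination_by σ => σ.length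
decreasing_by
  · exact Nat.lt_succ_of_le (List.length_filter_le _ _)
  · exact Nat.lt_succ_self _

/-- The profile `s` is a Nash equilibrium of the game `(I, σ)`: no worker gets a better assignment
by changing her own strategy only. -/
def IsNash (I : MatchingInstance P Q) (σ : List (P × Q)) (s : List Action → Action) : Prop :=
  ∀ (q : Q) (s' : List Action → Action), (∀ h, ¬ Moves σ h q → s' h = s h) →
    I.WorkerWeaklyPrefers q (outcome s σ) (outcome s' σ)

/-- The profile `s` is a subgame perfect equilibrium of `(I, σ)`: it induces a Nash equilibrium in
the subgame after every history. -/
def IsSPE (I : MatchingInstance P Q) (σ : List (P × Q)) (s : List Action → Action) : Prop :=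
  ∀ h, I.IsNash (subgame σ h) (fun h' => s (h ++ h'))

/-- `μ` is the outcome of a subgame perfect equilibrium of `(I, σ)`. -/
def IsSPEMatching (I : MatchingInstance P Q) (σ : List (P × Q)) (μ : Set (P × Q)) : Prop :=
  ∃ s, I.IsSPE σ s ∧ outcome s σ = μ

/-! ### The two-phase order -/

/-- The offers `(p, q)` such that `p` prefers `q` to its assignment in `μ`. -/
def betterOffers (I : MatchingInstance P Q) (μ : Set (P × Q)) : Set (P × Q) :=
  {e ∈ I.E | I.FirmPrefersTo μ e.1 e.2}

/-- The first `k` firms of `π` are obtained by `k` times choosing a pair of the worker-optimal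
stable matching of the current instance that is accepted earliest, listing its firm, and
contracting the pair. The firms after the first `k` are arbitrary. -/
def IsAcceptanceOrder : ℕ → MatchingInstance P Q → List P → Prop
  | 0, _, _ => True
  | _ + 1, _, [] => False
  | k + 1, I, p :: π => ∃ q, I.IsEarliestPair p q ∧ IsAcceptanceOrder k (I.contract (p, q)) π

/-- `σ` is a consistent offering order which starts with all the offers that the firms prefer to
their partners in `μ`, and in which the other offers follow a position order `π` on the set of all
firms (if a firm comes before another one in `π`, then so do their offers) that is given by the
acceptance order of the deferred acceptance algorithm. -/
def IsTwoPhaseOrder (I : MatchingInstance P Q) (μ : Set (P × Q)) (σ : List (P × Q)) : Prop :=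
  I.IsOfferingOrder σ ∧
  ∃ (σ₁ σ₂ : List (P × Q)) (π : List P),
    σ = σ₁ ++ σ₂ ∧ (∀ e, e ∈ σ₁ ↔ e ∈ I.betterOffers μ) ∧
    π.Nodup ∧ (∀ p, p ∈ π) ∧
    σ₂.Pairwise (fun e e' => π.idxOf e.1 ≤ π.idxOf e'.1) ∧
    ∃ μ', (I.delete (I.betterOffers μ)).IsWorkerOptimal μ' ∧
      IsAcceptanceOrder μ'.ncard (I.delete (I.betterOffers μ)) π

end Game

end MatchingInstance

namespace MatchingInstance

/-! ### Preferences -/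

/-! Preferences are strict and no offer is repeated, so the receiver of an offer is never
indifferent, and every subgame perfect equilibrium has the outcome of backward induction
(`IsOfferList.isSPEMatching_iff`). It remains to compute this outcome. Once the second phase is
known to produce `μ`, all offers of the first phase are rejected: an attractive one would block `μ`.

In the instance left for the second phase, `μ` is the only stable matching and every matched firm
has its favourite worker (`IsWorkerOptimal.isTight_delete`). A firm makes its first offer to its
partner, so every worker matched in `μ` does at least as well in the outcome `M`, and by counting,
`M` matches the same firms and workers as `μ`. If `M ≠ μ`, let `p` be the last firm in the order
that misses its partner; in `M` it has the partner `b` of an earlier firm. The acceptance order then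
supplies a worker `v` whom `p` prefers to `b`, and who prefers `p` to her partner in `μ`, if any, a
firm after `p` (`IsAcceptanceOrder.exists_better_proposer`). By the choice of `p`, that later firm
is also hers in `M`. Hence she would have accepted `p`, whose offer to her precedes the one to `b`
(`IsOfferList.not_blocks_later`).

The worker `v` comes from the market of `improving` pairs. Until the first pair of `μ` is accepted,
deferred acceptance makes improving proposals only, so the worker of an earliest pair is unmatched
in every stable matching `ν` of that market (`IsTight.unmatched_of_isEarliestPair`). A firm with
which she would improve therefore holds somebody better in `ν`. The exchange argument
`IsStable.exists_join` carries `ν` past a contraction without harming any remaining firm. It also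
shows that contraction preserves uniqueness of the stable matching (`IsTight.contract`), which makes
the induction along the acceptance order possible. -/

theorem exists_top_of_finite {α : Type*} {s : Set α} (hs : s.Finite) (r : α → α → Prop)
    (htrans : ∀ a ∈ s, ∀ b ∈ s, ∀ c ∈ s, r a b → r b c → r a c)
    (htotal : ∀ a ∈ s, ∀ b ∈ s, r a b ∨ a = b ∨ r b a) (hne : s.Nonempty) :
    ∃ m ∈ s, ∀ x ∈ s, x = m ∨ r m x := by
  induction s, hs using Set.Finite.induction_on with
  | empty => exact absurd hne Set.not_nonempty_empty
  | @insert a s _ _ ih =>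
    rcases s.eq_empty_or_nonempty with rfl | hs'
    · exact ⟨a, by simp, by simp⟩
    obtain ⟨m, hm, hmax⟩ := ih
      (fun x hx y hy z hz => htrans x (.inr hx) y (.inr hy) z (.inr hz))
      (fun x hx y hy => htotal x (.inr hx) y (.inr hy)) hs'
    have hm' : m ∈ insert a s := .inr hm
    have ha' : a ∈ insert a s := .inl rfl
    rcases htotal a ha' m hm' with h | h | h
    · refine ⟨a, ha', ?_⟩
      rintro x (rfl | hx)
      · exact .inl rfl
      rcases hmax x hx with rfl | h'
      · exact .inr h
      · exact .inr (htrans a ha' m hm' x (.inr hx) h h')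
    · subst h
      refine ⟨a, ha', ?_⟩
      rintro x (rfl | hx)
      · exact .inl rfl
      · exact hmax x hx
    · refine ⟨m, hm', ?_⟩
      rintro x (rfl | hx)
      · exact .inr h
      · exact hmax x hx

section Preferences

variable {P Q : Type*} (I : MatchingInstance P Q)

theorem worker_asymm {q : Q} {p p' : P} (h : (p, q) ∈ I.E) (h' : (p', q) ∈ I.E)
    (h₁ : I.workerPref q p p') (h₂ : I.workerPref q p' p) : False :=
  I.worker_irrefl q p h (I.worker_trans q p p' p h h' h h₁ h₂)

theorem firm_asymm {p : P} {q q' : Q} (h : (p, q) ∈ I.E) (h' : (p, q') ∈ I.E)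
    (h₁ : I.firmPref p q q') (h₂ : I.firmPref p q' q) : False :=
  I.firm_irrefl p q h (I.firm_trans p q q' q h h' h h₁ h₂)

theorem IsStable.subset {I : MatchingInstance P Q} {μ : Set (P × Q)} (h : I.IsStable μ) : μ ⊆ I.E :=
  h.1.1

theorem IsStable.firm_unique {I : MatchingInstance P Q} {μ : Set (P × Q)} (h : I.IsStable μ)
    {p : P} {q q' : Q} (h₁ : (p, q) ∈ μ) (h₂ : (p, q') ∈ μ) : q = q' :=
  h.1.2.1 p q q' h₁ h₂

theorem IsStable.worker_unique {I : MatchingInstance P Q} {μ : Set (P × Q)} (h : I.IsStable μ)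
    {q : Q} {p p' : P} (h₁ : (p, q) ∈ μ) (h₂ : (p', q) ∈ μ) : p = p' :=
  h.1.2.2 q p p' h₁ h₂

/-- A worker who would accept `p` shows that `p` has a better partner. -/
theorem IsStable.exists_firm_partner {I : MatchingInstance P Q} {μ : Set (P × Q)} (h : I.IsStable μ)
    {p : P} {q : Q} (hE : (p, q) ∈ I.E) (hw : I.WorkerPrefersTo μ q p) :
    ∃ q', (p, q') ∈ μ ∧ (q' = q ∨ I.firmPref p q' q) := by
  by_contra hcon
  push Not at hcon
  refine h.2 p q ⟨hE, fun q' hq' => ?_, hw⟩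
  rcases I.firm_total p q q' hE (h.subset hq') with h' | h' | h'
  · exact h'
  · exact absurd h'.symm (hcon q' hq').1
  · exact absurd h' (hcon q' hq').2

/-- A firm that would accept `q` shows that `q` has a better partner. -/
theorem IsStable.exists_worker_partner {I : MatchingInstance P Q} {μ : Set (P × Q)}
    (h : I.IsStable μ) {p : P} {q : Q} (hE : (p, q) ∈ I.E) (hf : I.FirmPrefersTo μ p q) :
    ∃ p', (p', q) ∈ μ ∧ (p' = p ∨ I.workerPref q p' p) := by
  by_contra hcon
  push Not at hcon
  refine h.2 p q ⟨hE, hf, fun p' hp' => ?_⟩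
  rcases I.worker_total q p p' hE (h.subset hp') with h' | h' | h'
  · exact h'
  · exact absurd h'.symm (hcon p' hp').1
  · exact absurd h' (hcon p' hp').2

theorem IsWorkerOptimal.unique {I : MatchingInstance P Q} {μ ν : Set (P × Q)}
    (hμ : I.IsWorkerOptimal μ) (hν : I.IsWorkerOptimal ν) : μ = ν := by
  have key : ∀ {μ ν : Set (P × Q)}, I.IsWorkerOptimal μ → I.IsWorkerOptimal ν → μ ⊆ ν := by
    rintro μ ν hμ hν ⟨p, q⟩ h
    obtain ⟨p₁, h₁, h₁'⟩ := hν.2 μ hμ.1 q p h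
    obtain ⟨p₂, h₂, h₂'⟩ := hμ.2 ν hν.1 q p₁ h₁
    obtain rfl := hμ.1.worker_unique h h₂
    rcases h₁' with rfl | h₁'
    · exact h₁
    rcases h₂' with rfl | h₂'
    · exact h₁
    exact (I.worker_asymm (hμ.1.subset h) (hν.1.subset h₁) h₂' h₁').elim
  exact (key hμ hν).antisymm (key hν hμ)

end Preferences

/-! ### Deferred acceptance -/

section DeferredAcceptance

variable {P Q : Type*} (I : MatchingInstance P Q)

/-- The properties of the states of the algorithm that are preserved by every iteration. -/
structure DAInvariant (S : DAState P Q) : Prop where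
  held_subset : S.held ⊆ S.remaining
  remaining_subset : S.remaining ⊆ I.E
  held_best : ∀ p q p', (p, q) ∈ S.held → (p', q) ∈ S.remaining → p' = p ∨ I.workerPref q p p'
  firm_unique : ∀ p q q', (p, q) ∈ S.held → (p, q') ∈ S.held → q = q'
  holds_better : ∀ p q, (p, q) ∈ I.E → (p, q) ∉ S.remaining →
    ∃ q', (p, q') ∈ S.held ∧ I.firmPref p q' q

variable {I} {S : DAState P Q}

theorem DAInvariant.proposals_subset (hS : I.DAInvariant S) : I.proposals S ⊆ S.remaining := by
  rintro e (he | he)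
  · exact hS.held_subset he
  · exact he.2.1

theorem DAInvariant.proposals_best (hS : I.DAInvariant S) {p p' : P} {q : Q}
    (h : (p, q) ∈ I.proposals S) (h' : (p', q) ∈ S.remaining) :
    p' = p ∨ I.workerPref q p p' := by
  rcases h with h | h
  · exact hS.held_best p q p' h h'
  · exact h.2.2 p' h'

theorem DAInvariant.exists_kept [Finite Q] (hS : I.DAInvariant S) {p : P} {q : Q}
    (h : (p, q) ∈ I.proposals S) : ∃ q', (p, q') ∈ I.kept S ∧ (q' = q ∨ I.firmPref p q' q) := by
  have hE : ∀ q ∈ {q | (p, q) ∈ I.proposals S}, (p, q) ∈ I.E := fun q hq =>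
    hS.remaining_subset (hS.proposals_subset hq)
  obtain ⟨m, hm, hmax⟩ := exists_top_of_finite (Set.toFinite {q | (p, q) ∈ I.proposals S})
    (I.firmPref p) (fun a ha b hb c hc => I.firm_trans p a b c (hE a ha) (hE b hb) (hE c hc))
    (fun a ha b hb => I.firm_total p a b (hE a ha) (hE b hb)) ⟨q, h⟩
  refine ⟨m, ⟨hm, fun x hx => hmax x hx⟩, ?_⟩
  rcases hmax q h with h' | h'
  · exact .inl h'.symm
  · exact .inr h'

theorem DAInvariant.daStep [Finite Q] (hS : I.DAInvariant S) : I.DAInvariant (I.daStep S) where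
  held_subset := fun _ he => ⟨hS.proposals_subset he.1, fun h => h.2 he⟩
  remaining_subset := fun _ he => hS.remaining_subset he.1
  held_best := fun _ _ _ h h' => hS.proposals_best h.1 h'.1
  firm_unique := by
    intro p q q' h h'
    have hE := hS.remaining_subset (hS.proposals_subset h.1)
    have hE' := hS.remaining_subset (hS.proposals_subset h'.1)
    rcases h.2 q' h'.1 with h₁ | h₁
    · exact h₁.symm
    rcases h'.2 q h.1 with h₂ | h₂
    · exact h₂
    exact (I.firm_asymm hE hE' h₁ h₂).elim
  holds_better := by
    intro p q hE hq
    by_cases hr : (p, q) ∈ S.remaining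
    · have hp : (p, q) ∈ I.proposals S \ I.kept S := by
        by_contra h
        exact hq ⟨hr, h⟩
      obtain ⟨q', hk, rfl | h⟩ := hS.exists_kept hp.1
      · exact absurd hk hp.2
      · exact ⟨q', hk, h⟩
    · obtain ⟨q₁, h₁, h₁'⟩ := hS.holds_better p q hE hr
      obtain ⟨q', hk, rfl | h⟩ := hS.exists_kept (q := q₁) (.inl h₁)
      · exact ⟨q', hk, h₁'⟩
      · exact ⟨q', hk, I.firm_trans p q' q₁ q
          (hS.remaining_subset (hS.proposals_subset hk.1))
          (hS.remaining_subset (hS.held_subset h₁)) hE h h₁'⟩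

variable (I)

theorem daInvariant_daState [Finite Q] (t : ℕ) : I.DAInvariant (I.daState t) := by
  induction t with
  | zero =>
    exact ⟨Set.empty_subset _, subset_rfl, fun _ _ _ h => h.elim, fun _ _ _ h => h.elim,
      fun _ _ h h' => absurd h h'⟩
  | succ t ih => exact ih.daStep

/-- A stable matching survives the rejections, as long as all proposals are made inside the
sub-instance in which it is stable. -/
theorem IsStable.subset_remaining [Finite Q] {E' : Set (P × Q)} (hE' : E' ⊆ I.E)
    {ν : Set (P × Q)} (hν : (I.restrict E' hE').IsStable ν) (t : ℕ)
    (hprop : ∀ s < t, I.proposals (I.daState s) ⊆ E') : ν ⊆ (I.daState t).remaining := by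
  induction t with
  | zero => exact hν.subset.trans hE'
  | succ t ih =>
    have ih := ih fun s hs => hprop s (hs.trans t.lt_succ_self)
    have hS := I.daInvariant_daState t
    rintro ⟨p, q⟩ h
    refine ⟨ih h, fun hrej => ?_⟩
    obtain ⟨q', hk, rfl | hq'⟩ := hS.exists_kept hrej.1
    · exact hrej.2 hk
    have hpq' : (p, q') ∈ E' := hprop t t.lt_succ_self hk.1
    -- The worker `q'` who displaced `q` proposed to her best remaining firm, and by induction her
    -- own partner in `ν` still remains; so `(p, q')` would block `ν`.
    refine hν.2 p q' ⟨hpq', fun q₁ h₁ => ?_, fun p' hp' => ?_⟩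
    · obtain rfl := hν.firm_unique h h₁
      exact hq'
    · rcases hS.proposals_best hk.1 (ih hp') with rfl | h'
      · obtain rfl := hν.firm_unique h hp'
        exact absurd hk hrej.2
      · exact h'

theorem IsStable.subset_remaining_self [Finite Q] {I : MatchingInstance P Q} {ν : Set (P × Q)}
    (hν : I.IsStable ν) (t : ℕ) : ν ⊆ (I.daState t).remaining :=
  IsStable.subset_remaining I (E' := I.E) subset_rfl hν t fun s _ =>
    (I.daInvariant_daState s).proposals_subset.trans (I.daInvariant_daState s).remaining_subset

/-- Each round with a rejection removes an acceptable pair, so at most `I.E.ncard` rounds can have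
one. -/
theorem exists_remaining_eq [Finite P] [Finite Q] :
    ∃ t, (I.daState (t + 1)).remaining = (I.daState t).remaining := by
  by_contra! hcon
  have hlt : ∀ t, (I.daState (t + 1)).remaining ⊂ (I.daState t).remaining := fun t =>
    lt_of_le_of_ne (fun _ h => h.1) (hcon t)
  have hcard : ∀ t, (I.daState t).remaining.ncard + t ≤ I.E.ncard := by
    intro t
    induction t with
    | zero => exact le_rfl
    | succ t ih =>
      have := Set.ncard_lt_ncard (hlt t) (Set.toFinite _)
      omega
  have := hcard (I.E.ncard + 1)
  omega

/-- In a round without rejections every proposal is kept, so each worker with a remaining firm holds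
her best one. A rejected pair cannot block, since its firm holds somebody better, and pairs of
stable matchings are never rejected, which gives optimality. -/
theorem exists_isWorkerOptimal_held [Finite P] [Finite Q] :
    ∃ t, I.IsWorkerOptimal (I.daState t).held := by
  obtain ⟨t, ht⟩ := I.exists_remaining_eq
  have hS := I.daInvariant_daState t
  have hS' := I.daInvariant_daState (t + 1)
  have hkept : I.proposals (I.daState t) ⊆ (I.daState (t + 1)).held := by
    intro e he
    by_contra hk
    have hmem : e ∈ (I.daState (t + 1)).remaining := ht ▸ hS.proposals_subset he
    exact hmem.2 ⟨he, hk⟩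
  have hmatched : ∀ p q, (p, q) ∈ (I.daState (t + 1)).remaining →
      ∃ p', (p', q) ∈ (I.daState (t + 1)).held ∧ (p' = p ∨ I.workerPref q p' p) := by
    intro p q h
    suffices ∃ p', (p', q) ∈ (I.daState (t + 1)).held by
      obtain ⟨p', hp'⟩ := this
      refine ⟨p', hp', ?_⟩
      rcases hS'.held_best p' q p hp' h with h' | h'
      · exact .inl h'.symm
      · exact .inr h'
    by_cases hheld : ∃ p', (p', q) ∈ (I.daState t).held
    · obtain ⟨p', hp'⟩ := hheld
      exact ⟨p', hkept (.inl hp')⟩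
    have hE : ∀ p' ∈ {p' | (p', q) ∈ (I.daState t).remaining}, (p', q) ∈ I.E := fun p' hp' =>
      hS.remaining_subset hp'
    obtain ⟨m, hm, hmax⟩ := exists_top_of_finite
      (Set.toFinite {p' | (p', q) ∈ (I.daState t).remaining}) (I.workerPref q)
      (fun a ha b hb c hc => I.worker_trans q a b c (hE a ha) (hE b hb) (hE c hc))
      (fun a ha b hb => I.worker_total q a b (hE a ha) (hE b hb)) ⟨p, ht ▸ h⟩
    exact ⟨m, hkept (.inr ⟨fun p' hp' => hheld ⟨p', hp'⟩, hm, hmax⟩)⟩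
  have hsub : (I.daState (t + 1)).held ⊆ I.E := hS'.held_subset.trans hS'.remaining_subset
  refine ⟨t + 1, ⟨⟨hsub, hS'.firm_unique, ?_⟩, ?_⟩, ?_⟩
  · intro q p p' h h'
    rcases hS'.held_best p q p' h (hS'.held_subset h') with h₁ | h₁
    · exact h₁.symm
    rcases hS'.held_best p' q p h' (hS'.held_subset h) with h₂ | h₂
    · exact h₂
    exact (I.worker_asymm (hsub h) (hsub h') h₁ h₂).elim
  · rintro p q ⟨hE, hf, hw⟩
    by_cases hr : (p, q) ∈ (I.daState (t + 1)).remaining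
    · obtain ⟨p', hp', rfl | h⟩ := hmatched p q hr
      · exact I.worker_irrefl q p' hE (hw p' hp')
      · exact I.worker_asymm hE (hsub hp') (hw p' hp') h
    · obtain ⟨q', hq', h⟩ := hS'.holds_better p q hE hr
      exact I.firm_asymm hE (hsub hq') (hf q' hq') h
  · intro ν hν q p h
    exact hmatched p q (hν.subset_remaining_self (t + 1) h)

theorem exists_isWorkerOptimal [Finite P] [Finite Q] : ∃ μ, I.IsWorkerOptimal μ :=
  let ⟨_, ht⟩ := I.exists_isWorkerOptimal_held
  ⟨_, ht⟩

theorem IsWorkerOptimal.exists_mem_held [Finite P] [Finite Q] {I : MatchingInstance P Q}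
    {μ : Set (P × Q)} (hμ : I.IsWorkerOptimal μ) : ∃ t, μ ⊆ (I.daState t).held :=
  let ⟨t, ht⟩ := I.exists_isWorkerOptimal_held
  ⟨t, (hμ.unique ht).subset⟩

end DeferredAcceptance


/-! ### Tight instances, improving pairs and contraction -/

section Tight

variable {P Q : Type*} {I : MatchingInstance P Q}

theorem firm_not_lt_of_le {p : P} {q q' : Q} (h : (p, q) ∈ I.E) (h' : (p, q') ∈ I.E)
    (h₁ : q' = q ∨ I.firmPref p q' q) (h₂ : I.firmPref p q q') : False := by
  rcases h₁ with rfl | h₁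
  · exact I.firm_irrefl p q' h h₂
  · exact I.firm_asymm h h' h₂ h₁

theorem firm_le_trans {p : P} {q₁ q₂ q₃ : Q} (h₁ : (p, q₁) ∈ I.E) (h₂ : (p, q₂) ∈ I.E)
    (h₃ : (p, q₃) ∈ I.E) (h₁₂ : q₁ = q₂ ∨ I.firmPref p q₁ q₂) (h₂₃ : q₂ = q₃ ∨ I.firmPref p q₂ q₃) :
    q₁ = q₃ ∨ I.firmPref p q₁ q₃ := by
  rcases h₁₂ with rfl | h₁₂
  · exact h₂₃
  rcases h₂₃ with rfl | h₂₃
  · exact .inr h₁₂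
  · exact .inr (I.firm_trans p q₁ q₂ q₃ h₁ h₂ h₃ h₁₂ h₂₃)

/-- `μ` is the only stable matching of `I`, and every firm matched in `μ` likes its partner
best. -/
structure IsTight (I : MatchingInstance P Q) (μ : Set (P × Q)) : Prop where
  stable : I.IsStable μ
  eq_of_stable : ∀ ν, I.IsStable ν → ν = μ
  top : ∀ p q q', (p, q) ∈ μ → (p, q') ∈ I.E → q' = q ∨ I.firmPref p q q'

/-- The acceptable pairs that the worker prefers to her assignment in `μ`. -/
def improving (I : MatchingInstance P Q) (μ : Set (P × Q)) : Set (P × Q) :=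
  {e ∈ I.E | I.WorkerPrefersTo μ e.2 e.1}

theorem improving_subset (I : MatchingInstance P Q) (μ : Set (P × Q)) : I.improving μ ⊆ I.E :=
  fun _ h => h.1

/-- This closure property is what lets `IsStable.exists_join` be applied to the improving pairs. -/
theorem improving_upward {μ : Set (P × Q)} (hμ : μ ⊆ I.E) {p p' : P} {q : Q}
    (h : (p, q) ∈ I.improving μ) (hE : (p', q) ∈ I.E) (hp : I.workerPref q p' p) :
    (p', q) ∈ I.improving μ :=
  ⟨hE, fun p₁ h₁ => I.worker_trans q p' p p₁ hE h.1 (hμ h₁) hp (h.2 p₁ h₁)⟩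

theorem IsTight.isWorkerOptimal [Finite P] [Finite Q] {μ : Set (P × Q)} (hμ : I.IsTight μ) :
    I.IsWorkerOptimal μ := by
  obtain ⟨ν, hν⟩ := I.exists_isWorkerOptimal
  rwa [hμ.eq_of_stable ν hν.1] at hν

theorem IsTight.mem_of_isEarliestPair [Finite P] [Finite Q] {μ : Set (P × Q)} (hμ : I.IsTight μ)
    {p : P} {q : Q} (h : I.IsEarliestPair p q) : (p, q) ∈ μ := by
  obtain ⟨μ', hopt, hmem, -⟩ := h
  rwa [← hμ.eq_of_stable μ' hopt.1]

/-- The worker of an earliest pair is unmatched in the stable matchings of the instance in which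
workers only consider firms better than their stable partners. -/
theorem IsTight.unmatched_of_isEarliestPair [Finite P] [Finite Q] {μ : Set (P × Q)}
    (hμ : I.IsTight μ) {p : P} {q : Q} (h : I.IsEarliestPair p q) {ν : Set (P × Q)}
    (hν : (I.restrict _ (I.improving_subset μ)).IsStable ν) (p' : P) : (p', q) ∉ ν := by
  obtain ⟨μ', hopt, hmem, t, hacc, hmin⟩ := h
  obtain rfl := hμ.eq_of_stable μ' hopt.1
  have hnot : ∀ s < t, ∀ a b, (a, b) ∈ μ' → (a, b) ∉ (I.daState s).held := by
    intro s hs a b hab hheld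
    classical
    have hex : ∃ s, (a, b) ∈ (I.daState s).held := ⟨s, hheld⟩
    have h₁ := hmin a b (Nat.find hex) hab
      ⟨Nat.find_spec hex, fun t' ht' => Nat.find_min hex ht'⟩
    have h₂ : Nat.find hex ≤ s := Nat.find_min' hex hheld
    omega
  cases t with
  | zero => exact absurd hacc.1 (Set.notMem_empty _)
  | succ s =>
    have hS := I.daInvariant_daState s
    -- A proposal that is not improving goes to the stable partner, who is never crossed off the
    -- worker's list. That firm ranks her first and would keep her in round `r + 1 < t`, against the
    -- minimality of `t`.
    have hprop : ∀ r < s, I.proposals (I.daState r) ⊆ I.improving μ' := by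
      rintro r hr ⟨a, b⟩ hab
      have hR := I.daInvariant_daState r
      refine ⟨hR.remaining_subset (hR.proposals_subset hab), fun c hc => ?_⟩
      rcases hR.proposals_best hab (hμ.stable.subset_remaining_self r hc) with rfl | h'
      · refine absurd ?_ (hnot (r + 1) (by omega) _ _ hc)
        exact ⟨hab, fun x hx =>
          hμ.top _ _ _ hc (hR.remaining_subset (hR.proposals_subset hx))⟩
      · exact h'
    intro hp'
    have himp := hν.subset hp'
    -- A partner of `q` in `ν` would still remain, so `q`, who now proposes to `p`, weakly prefers
    -- `p` to it; yet pairs of `ν` are improving.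
    have hp := hS.proposals_best hacc.1.1
      (IsStable.subset_remaining I (I.improving_subset μ') hν s hprop hp')
    have hlt : I.workerPref q p' p := himp.2 p hmem
    have hE := hμ.stable.subset hmem
    rcases hp with rfl | hp
    · exact I.worker_irrefl _ _ hE hlt
    · exact I.worker_asymm hE himp.1 hp hlt

/-- The better of two stable matchings for the firms, where the second one belongs to a
sub-instance without a firm `p₁` and a worker `q₁` who is unmatched in the first one. -/
theorem IsStable.exists_join [Finite P] {E₁ E₂ : Set (P × Q)} {hE₁ : E₁ ⊆ I.E} {hE₂ : E₂ ⊆ I.E}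
    {ν₁ ν₂ : Set (P × Q)} (h₁ : (I.restrict E₁ hE₁).IsStable ν₁)
    (h₂ : (I.restrict E₂ hE₂).IsStable ν₂) {p₁ : P} {q₁ : Q} (hq₁ : ∀ p, (p, q₁) ∉ ν₁)
    (hsub : ∀ p q, (p, q) ∈ E₁ → p ≠ p₁ → q ≠ q₁ → (p, q) ∈ E₂)
    (hp₁ : ∀ p q, (p, q) ∈ E₂ → p ≠ p₁)
    (hup : ∀ p p' q, (p, q) ∈ E₁ → (p', q) ∈ E₂ → I.workerPref q p' p → (p', q) ∈ E₁) :
    ∃ ν, (I.restrict E₂ hE₂).IsStable ν ∧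
      (∀ p q, p ≠ p₁ → (p, q) ∈ ν₁ → ∃ q', (p, q') ∈ ν ∧ (q' = q ∨ I.firmPref p q' q)) ∧
      (Disjoint ν₁ ν → ν = ν₂) := by
  have hν₁ : ν₁ ⊆ E₁ := h₁.subset
  have hν₂ : ν₂ ⊆ E₂ := h₂.subset
  -- The firms of `T` will keep their partners in `ν₁`, all others those in `ν₂`.
  let T : Set P := {p | p ≠ p₁ ∧ ∃ q, (p, q) ∈ ν₁ ∧ I.FirmPrefersTo ν₂ p q}
  have hT : ∀ p ∈ T, ∀ q, (p, q) ∈ ν₁ → I.FirmPrefersTo ν₂ p q := by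
    rintro p ⟨-, q', hq', hf⟩ q hq
    rwa [h₁.firm_unique hq hq']
  have hTE : ∀ p ∈ T, ∀ q, (p, q) ∈ ν₁ → (p, q) ∈ E₂ := fun p hp q hq =>
    hsub p q (hν₁ hq) hp.1 fun h => hq₁ p (h ▸ hq)
  -- Since `(p, q)` does not block `ν₂`, the worker `q` has a better firm `p'` there. By `hup` the
  -- pair `(p', q)` lies in `E₁`, and as it does not block `ν₁`, the firm `p'` is in `T` as well.
  have fwd : ∀ p ∈ T, ∀ q, (p, q) ∈ ν₁ → ∃ p' ∈ T, (p', q) ∈ ν₂ := by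
    intro p hp q hq
    have hE := hTE p hp q hq
    obtain ⟨p', hp', rfl | hlt⟩ := h₂.exists_worker_partner hE (hT p hp q hq)
    · exact (I.firm_irrefl p' q (hE₂ hE) (hT p' hp q hq q hp')).elim
    have hlt : I.workerPref q p' p := hlt
    have hE' : (p', q) ∈ E₁ := hup p p' q (hν₁ hq) (hν₂ hp') hlt
    obtain ⟨q', hq', rfl | hlt'⟩ := h₁.exists_firm_partner hE' (fun p'' hp'' => by
      obtain rfl := h₁.worker_unique hq hp''
      exact hlt)
    · obtain rfl := h₁.worker_unique hq hq'
      exact (I.worker_irrefl _ _ (hE₂ hE) hlt).elim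
    · refine ⟨p', ⟨hp₁ _ _ (hν₂ hp'), q', hq', fun q'' hq'' => ?_⟩, hp'⟩
      obtain rfl := h₂.firm_unique hp' hq''
      exact hlt'
  -- Passing from `p` to the `ν₂`-partner of its `ν₁`-partner is an injection of the finite set `T`
  -- into itself, hence a bijection. So `ν₁` and `ν₂` match `T` to the same workers.
  have bwd : ∀ p ∈ T, ∀ q, (p, q) ∈ ν₂ → ∃ p' ∈ T, (p', q) ∈ ν₁ := by
    have hex : ∀ p : T, ∃ p' : T, ∃ q, (p.1, q) ∈ ν₁ ∧ (p'.1, q) ∈ ν₂ := by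
      rintro ⟨p, hp⟩
      obtain ⟨-, q, hq, -⟩ := id hp
      obtain ⟨p', hp', h⟩ := fwd p hp q hq
      exact ⟨⟨p', hp'⟩, q, hq, h⟩
    choose f hf using hex
    have hinj : Function.Injective f := by
      intro a b hab
      obtain ⟨q, ha, ha'⟩ := hf a
      obtain ⟨q', hb, hb'⟩ := hf b
      rw [hab] at ha'
      obtain rfl := h₂.firm_unique ha' hb'
      exact Subtype.ext (h₁.worker_unique ha hb)
    intro p hp q hq
    obtain ⟨a, ha⟩ := Finite.injective_iff_surjective.1 hinj ⟨p, hp⟩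
    obtain ⟨q', hq', hq''⟩ := hf a
    rw [ha] at hq''
    obtain rfl := h₂.firm_unique hq hq''
    exact ⟨a, a.2, hq'⟩
  have hnT : ∀ p q, p ≠ p₁ → p ∉ T → (p, q) ∈ ν₁ →
      ∃ q', (p, q') ∈ ν₂ ∧ (q' = q ∨ I.firmPref p q' q) := by
    intro p q hp hpT hq
    by_contra! hcon
    refine hpT ⟨hp, q, hq, fun q' hq' => ?_⟩
    rcases I.firm_total p q q' (hE₁ (hν₁ hq)) (hE₂ (hν₂ hq')) with h | h | h
    · exact h
    · exact absurd h.symm (hcon q' hq').1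
    · exact absurd h (hcon q' hq').2
  let ν : Set (P × Q) := {e | (e.1 ∈ T ∧ e ∈ ν₁) ∨ (e.1 ∉ T ∧ e ∈ ν₂)}
  have hνE : ν ⊆ E₂ := by
    rintro ⟨p, q⟩ (h | h)
    · exact hTE p h.1 q h.2
    · exact hν₂ h.2
  refine ⟨ν, ⟨⟨hνE, ?_, ?_⟩, ?_⟩, ?_, ?_⟩
  · rintro p q q' (h | h) (h' | h')
    · exact h₁.firm_unique h.2 h'.2
    · exact absurd h.1 h'.1
    · exact absurd h'.1 h.1
    · exact h₂.firm_unique h.2 h'.2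
  · have mixed : ∀ q p p', p ∈ T → (p, q) ∈ ν₁ → p' ∉ T → (p', q) ∈ ν₂ → p = p' := by
      intro q p p' hp hq hp' hq'
      obtain ⟨p'', hp'', h⟩ := fwd p hp q hq
      exact absurd (h₂.worker_unique h hq' ▸ hp'') hp'
    rintro q p p' (h | h) (h' | h')
    · exact h₁.worker_unique h.2 h'.2
    · exact mixed q p p' h.1 h.2 h'.1 h'.2
    · exact (mixed q p' p h'.1 h'.2 h.1 h.2).symm
    · exact h₂.worker_unique h.2 h'.2
  · rintro p q ⟨hE, hf, hw⟩
    have hE : (p, q) ∈ E₂ := hE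
    -- If `q` is matched from `ν₁`, then `hup` puts the blocking pair into `E₁` and stability of
    -- `ν₁` applies. Otherwise, by `bwd`, her partner in `ν₂`, if any, is also her partner in the
    -- join, and stability of `ν₂` applies.
    by_cases hW : ∃ p₀ ∈ T, (p₀, q) ∈ ν₁
    · obtain ⟨p₀, hp₀, hp₀q⟩ := hW
      have hlt : I.workerPref q p p₀ := hw p₀ (.inl ⟨hp₀, hp₀q⟩)
      obtain ⟨q', hq', hle⟩ := h₁.exists_firm_partner (hup p₀ p q (hν₁ hp₀q) hE hlt)
        (fun p'' hp'' => by
          obtain rfl := h₁.worker_unique hp₀q hp''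
          exact hlt)
      by_cases hpT : p ∈ T
      · exact firm_not_lt_of_le (hE₂ hE) (hE₁ (hν₁ hq')) hle (hf q' (.inl ⟨hpT, hq'⟩))
      · obtain ⟨q'', hq'', hle'⟩ := hnT p q' (hp₁ _ _ hE) hpT hq'
        exact firm_not_lt_of_le (hE₂ hE) (hE₂ (hν₂ hq''))
          (firm_le_trans (hE₂ (hν₂ hq'')) (hE₁ (hν₁ hq')) (hE₂ hE) hle' hle)
          (hf q'' (.inr ⟨hpT, hq''⟩))
    · obtain ⟨q', hq', hle⟩ := h₂.exists_firm_partner hE (fun p' hp' => by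
        refine hw p' (.inr ⟨fun hT' => hW (bwd p' hT' q hp'), hp'⟩))
      by_cases hpT : p ∈ T
      · obtain ⟨-, q₀, hq₀, hf₀⟩ := id hpT
        have hlt : I.firmPref p q q₀ := hf q₀ (.inl ⟨hpT, hq₀⟩)
        exact firm_not_lt_of_le (hE₂ hE) (hE₁ (hν₁ hq₀))
          (firm_le_trans (hE₁ (hν₁ hq₀)) (hE₂ (hν₂ hq')) (hE₂ hE) (.inr (hf₀ q' hq')) hle) hlt
      · exact firm_not_lt_of_le (hE₂ hE) (hE₂ (hν₂ hq')) hle (hf q' (.inr ⟨hpT, hq'⟩))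
  · intro p q hp hq
    by_cases hpT : p ∈ T
    · exact ⟨q, .inl ⟨hpT, hq⟩, .inl rfl⟩
    · obtain ⟨q', hq', hle⟩ := hnT p q hp hpT hq
      exact ⟨q', .inr ⟨hpT, hq'⟩, hle⟩
  · intro hdisj
    have hempty : ∀ p, p ∉ T := by
      rintro p hp
      obtain ⟨-, q, hq, -⟩ := id hp
      exact Set.disjoint_left.1 hdisj hq (.inl ⟨hp, hq⟩)
    ext e
    constructor
    · rintro (h | h)
      · exact absurd h.1 (hempty _)
      · exact h.2
    · exact fun h => .inr ⟨hempty _, h⟩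

/-- Contracting an earliest pair preserves the uniqueness of the stable matching. -/
theorem IsTight.contract [Finite P] [Finite Q] {μ : Set (P × Q)} (hμ : I.IsTight μ) {p : P} {q : Q}
    (h : I.IsEarliestPair p q) : (I.contract (p, q)).IsTight (μ \ {(p, q)}) := by
  have hmem := hμ.mem_of_isEarliestPair h
  have hne : ∀ {a b}, (a, b) ∈ μ → (a, b) ≠ (p, q) → a ≠ p ∧ b ≠ q := by
    refine fun hab hab' => ⟨?_, ?_⟩
    · rintro rfl
      exact hab' (by rw [hμ.stable.firm_unique hab hmem])
    · rintro rfl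
      exact hab' (by rw [hμ.stable.worker_unique hab hmem])
  refine ⟨⟨⟨?_, ?_, ?_⟩, ?_⟩, ?_, ?_⟩
  · rintro ⟨a, b⟩ hab
    exact ⟨hμ.stable.subset hab.1, hne hab.1 hab.2⟩
  · exact fun a b b' hb hb' => hμ.stable.firm_unique hb.1 hb'.1
  · exact fun b a a' ha ha' => hμ.stable.worker_unique ha.1 ha'.1
  · rintro a b ⟨hE, hf, hw⟩
    refine hμ.stable.2 a b ⟨hE.1, fun b' hb' => hf b' ⟨hb', ?_⟩, fun a' ha' => hw a' ⟨ha', ?_⟩⟩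
    · exact fun h => hE.2.1 (Prod.ext_iff.1 h).1
    · exact fun h => hE.2.2 (Prod.ext_iff.1 h).2
  -- Join `ν₂` with a stable matching `ν₁` of the improving pairs. Adding `(p, q)` to the join gives
  -- a stable matching of `I`, hence `μ`.
  · intro ν₂ hν₂
    obtain ⟨ν₁, hν₁, -⟩ := (I.restrict _ (I.improving_subset μ)).exists_isWorkerOptimal
    have hq : ∀ a, (a, q) ∉ ν₁ := hμ.unmatched_of_isEarliestPair h hν₁
    obtain ⟨ν, hν, hle, hdisj⟩ := IsStable.exists_join (I := I) (p₁ := p) (q₁ := q) hν₁ hν₂ hq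
      (fun a b hab ha hb => ⟨hab.1, ha, hb⟩) (fun a b hab => hab.2.1)
      (fun a a' b hab hab' => improving_upward hμ.stable.subset hab hab'.1)
    have hνE : ∀ {a b}, (a, b) ∈ ν → (a, b) ∈ I.E ∧ a ≠ p ∧ b ≠ q := fun hab => hν.subset hab
    have hins : I.IsStable (insert (p, q) ν) := by
      refine ⟨⟨?_, ?_, ?_⟩, ?_⟩
      · rintro ⟨a, b⟩ (hab | hab)
        · exact hab ▸ hμ.stable.subset hmem
        · exact (hνE hab).1
      · rintro a b b' (hb | hb) (hb' | hb')
        · exact (Prod.ext_iff.1 (hb.trans hb'.symm)).2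
        · exact absurd (congrArg Prod.fst hb) (hνE hb').2.1
        · exact absurd (congrArg Prod.fst hb') (hνE hb).2.1
        · exact hν.firm_unique hb hb'
      · rintro b a a' (ha | ha) (ha' | ha')
        · exact (Prod.ext_iff.1 (ha.trans ha'.symm)).1
        · exact absurd (congrArg Prod.snd ha) (hνE ha').2.2
        · exact absurd (congrArg Prod.snd ha') (hνE ha).2.2
        · exact hν.worker_unique ha ha'
      · rintro a b ⟨hE, hf, hw⟩
        by_cases ha : a = p
        · subst ha
          exact firm_not_lt_of_le hE (hμ.stable.subset hmem)
            ((hμ.top a q b hmem hE).imp Eq.symm id) (hf q (.inl rfl))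
        -- A pair `(a, q)` blocking the enlarged join is improving. As `q` is unmatched in `ν₁`, the
        -- firm `a` has a better worker in `ν₁` and hence in the join.
        by_cases hb : b = q
        · subst hb
          have himp : (a, b) ∈ I.improving μ := by
            refine ⟨hE, fun c hc => ?_⟩
            obtain rfl := hμ.stable.worker_unique hmem hc
            exact hw p (.inl rfl)
          obtain ⟨b₁, h₁, hle₁⟩ := hν₁.exists_firm_partner himp fun c hc => absurd hc (hq c)
          obtain ⟨b₂, h₂, hle₂⟩ := hle a b₁ ha h₁
          exact firm_not_lt_of_le hE (hνE h₂).1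
            (firm_le_trans (hνE h₂).1 (hν₁.subset h₁).1 hE hle₂ hle₁) (hf b₂ (.inr h₂))
        · exact hν.2 a b ⟨⟨hE, ha, hb⟩, fun b' hb' => hf b' (.inr hb'),
            fun a' ha' => hw a' (.inr ha')⟩
    have heq := hμ.eq_of_stable _ hins
    -- The join is now contained in `μ`, while no improving pair is in `μ`. So nothing was taken
    -- from `ν₁`.
    obtain rfl : ν = ν₂ := by
      refine hdisj (Set.disjoint_left.2 ?_)
      rintro ⟨a, b⟩ hab hab'
      have himp := hν₁.subset hab
      exact I.worker_irrefl b a himp.1 (himp.2 a (heq ▸ Set.mem_insert_of_mem _ hab'))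
    rw [← heq, Set.insert_sdiff_of_mem _ (Set.mem_singleton _), Set.sdiff_singleton_eq_self]
    exact fun h => (hνE h).2.1 rfl
  · exact fun a b b' hab hE => hμ.top a b b' hab.1 hE.1

theorem IsTight.exists_isEarliestPair [Finite P] [Finite Q] {μ : Set (P × Q)} (hμ : I.IsTight μ)
    (hne : μ.Nonempty) : ∃ p q, I.IsEarliestPair p q := by
  classical
  obtain ⟨t₀, ht₀⟩ := hμ.isWorkerOptimal.exists_mem_held
  obtain ⟨⟨a, b⟩, hab⟩ := hne
  have hex : ∃ t, ∃ p q, (p, q) ∈ μ ∧ (p, q) ∈ (I.daState t).held := ⟨t₀, a, b, hab, ht₀ hab⟩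
  obtain ⟨p, q, hmem, hheld⟩ := Nat.find_spec hex
  refine ⟨p, q, μ, hμ.isWorkerOptimal, hmem, Nat.find hex, ⟨hheld, fun t' ht' h => ?_⟩, ?_⟩
  · exact Nat.find_min hex ht' ⟨p, q, hmem, h⟩
  · exact fun p' q' t' hmem' hacc => Nat.find_min' hex ⟨p', q', hmem', hacc.1⟩

/-- A tight instance has an acceptance order, consisting of its matched firms and continued
arbitrarily. -/
theorem IsTight.exists_isAcceptanceOrder [Finite P] [Finite Q] (k : ℕ) :
    ∀ {I : MatchingInstance P Q} {μ : Set (P × Q)}, I.IsTight μ → μ.ncard = k →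
      ∃ π : List P, π.Nodup ∧ (∀ p ∈ π, ∃ q, (p, q) ∈ μ) ∧
        ∀ π', IsAcceptanceOrder k I (π ++ π') := by
  induction k with
  | zero => exact fun _ _ => ⟨[], by simp, by simp, fun _ => trivial⟩
  | succ k ih =>
    intro I μ hμ hk
    obtain ⟨p, q, hear⟩ := hμ.exists_isEarliestPair
      (Set.nonempty_of_ncard_ne_zero (by omega))
    have hmem := hμ.mem_of_isEarliestPair hear
    obtain ⟨π, hnodup, hπ, hacc⟩ := ih (hμ.contract hear)
      (by rw [Set.ncard_sdiff_singleton_of_mem hmem, hk, Nat.add_sub_cancel])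
    refine ⟨p :: π, List.nodup_cons.2 ⟨fun h => ?_, hnodup⟩, ?_, fun π' => ⟨q, hear, hacc π'⟩⟩
    · obtain ⟨q', hq'⟩ := hπ p h
      exact hq'.2 (by rw [hμ.stable.firm_unique hq'.1 hmem]; rfl)
    · intro p' hp'
      rcases List.mem_cons.1 hp' with rfl | hp'
      · exact ⟨q, hmem⟩
      · obtain ⟨q', hq'⟩ := hπ p' hp'
        exact ⟨q', hq'.1⟩

end Tight

/-! ### Improving proposals along an acceptance order -/

section AcceptanceOrder

variable {P Q : Type*} [Finite P] [Finite Q] [DecidableEq P]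

/-- Along an acceptance order, a firm that holds `q₀` in a stable matching of the improving pairs
still has an improving proposal at least as good as `q₀` when its turn comes. -/
theorem IsAcceptanceOrder.exists_proposer (π : List P) :
    ∀ {k : ℕ} {I : MatchingInstance P Q} {μ ν : Set (P × Q)} {p : P} {q q₀ : Q},
      I.IsTight μ → μ.ncard = k → IsAcceptanceOrder k I π →
      (I.restrict _ (I.improving_subset μ)).IsStable ν → (p, q) ∈ μ → (p, q₀) ∈ ν →
      ∃ v, (p, v) ∈ I.E ∧ v ≠ q ∧ (v = q₀ ∨ I.firmPref p v q₀) ∧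
        ∀ p', (p', v) ∈ μ → I.workerPref v p p' ∧ π.idxOf p ≤ π.idxOf p' := by
  induction π with
  | nil =>
    intro k I μ ν p q q₀ _ hk hacc _ hmem _
    cases k with
    | zero => exact absurd hmem (by rw [(Set.ncard_eq_zero).1 hk]; exact Set.notMem_empty _)
    | succ k => exact hacc.elim
  | cons p₁ π ih =>
    intro k I μ ν p q q₀ hμ hk hacc hν hmem hq₀
    cases k with
    | zero => exact absurd hmem (by rw [(Set.ncard_eq_zero).1 hk]; exact Set.notMem_empty _)
    | succ k =>
      obtain ⟨q₁, hear, hacc⟩ := hacc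
      have hmem₁ := hμ.mem_of_isEarliestPair hear
      have hun := hμ.unmatched_of_isEarliestPair hear hν
      have himp := hν.subset hq₀
      -- At the turn of `p` itself, `q₀` is the witness; she differs from `q`, who is unmatched in
      -- `ν`.
      by_cases hp : p = p₁
      · subst hp
        obtain rfl := hμ.stable.firm_unique hmem hmem₁
        exact ⟨q₀, himp.1, fun h => hun p (h ▸ hq₀), .inl rfl, fun p' hp' =>
          ⟨himp.2 p' hp', by simp⟩⟩
      have hμ₁ := hμ.contract hear
      have hE₂ : (I.contract (p₁, q₁)).improving (μ \ {(p₁, q₁)}) ⊆ I.E := fun e he => he.1.1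
      obtain ⟨ν₂, hν₂, -⟩ :=
        ((I.contract (p₁, q₁)).restrict _ (improving_subset _ (μ \ {(p₁, q₁)}))).exists_isWorkerOptimal
      have hE_iff : ∀ a b, (a, b) ∈ (I.contract (p₁, q₁)).improving (μ \ {(p₁, q₁)}) ↔
          (a, b) ∈ I.improving μ ∧ a ≠ p₁ ∧ b ≠ q₁ := by
        intro a b
        constructor
        · rintro ⟨⟨hE, ha, hb⟩, hw⟩
          exact ⟨⟨hE, fun c hc => hw c ⟨hc, fun h => hb (Prod.ext_iff.1 h).2⟩⟩, ha, hb⟩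
        · rintro ⟨⟨hE, hw⟩, ha, hb⟩
          exact ⟨⟨hE, ha, hb⟩, fun c hc => hw c hc.1⟩
      -- The join moves `ν` to the improving pairs of the contracted instance, where `p` does at
      -- least as well as with `q₀`.
      obtain ⟨ν', hν', hle, -⟩ := IsStable.exists_join (I := I) (hE₂ := hE₂) (ν₂ := ν₂) (p₁ := p₁)
        hν hν₂ hun (fun a b hab ha hb => (hE_iff a b).2 ⟨hab, ha, hb⟩)
        (fun a b hab => ((hE_iff a b).1 hab).2.1)
        (fun a a' b hab hab' _ => ((hE_iff a' b).1 hab').1)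
      obtain ⟨q', hq', hle'⟩ := hle p q₀ hp hq₀
      have hcard : (μ \ {(p₁, q₁)}).ncard = k := by
        rw [Set.ncard_sdiff_singleton_of_mem hmem₁, hk, Nat.add_sub_cancel]
      obtain ⟨v, hvE, hvq, hvle, hv⟩ := ih hμ₁ hcard hacc hν'
        ⟨hmem, fun h => hp (congrArg Prod.fst h)⟩ hq'
      refine ⟨v, hvE.1, hvq, firm_le_trans hvE.1 (hE₂ (hν'.subset hq')) himp.1 hvle hle', ?_⟩
      intro p' hp'
      have hne : (p', v) ≠ (p₁, q₁) := fun h => hvE.2.2 (Prod.ext_iff.1 h).2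
      have hp'₁ : p' ≠ p₁ := fun h => hvE.2.2 (hμ.stable.firm_unique (h ▸ hp') hmem₁)
      obtain ⟨h₁, h₂⟩ := hv p' ⟨hp', hne⟩
      refine ⟨h₁, ?_⟩
      rw [List.idxOf_cons_ne _ (Ne.symm hp), List.idxOf_cons_ne _ (Ne.symm hp'₁)]
      omega

/-- If a firm later in an acceptance order improves upon the stable partner of a worker, then at
its turn it has a better improving proposal by a worker who is still present. -/
theorem IsAcceptanceOrder.exists_better_proposer (π : List P) :
    ∀ {k : ℕ} {I : MatchingInstance P Q} {μ : Set (P × Q)} {p p' : P} {q q' : Q},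
      I.IsTight μ → μ.ncard = k → IsAcceptanceOrder k I π → (p, q) ∈ μ → (p', q') ∈ μ →
      π.idxOf p' < π.idxOf p → (p, q') ∈ I.E → I.workerPref q' p p' →
      ∃ v, (p, v) ∈ I.E ∧ v ≠ q ∧ I.firmPref p v q' ∧
        ∀ a, (a, v) ∈ μ → I.workerPref v p a ∧ π.idxOf p ≤ π.idxOf a := by
  induction π with
  | nil => intro k I μ p p' q q' _ _ _ _ _ hlt; simp at hlt
  | cons p₁ π ih =>
    intro k I μ p p' q q' hμ hk hacc hmem hmem' hlt hE hpref
    have hp : p ≠ p₁ := by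
      rintro rfl
      simp at hlt
    have hord := hacc
    cases k with
    | zero => exact absurd hmem (by rw [(Set.ncard_eq_zero).1 hk]; exact Set.notMem_empty _)
    | succ k =>
      obtain ⟨q₁, hear, hacc⟩ := hacc
      have hmem₁ := hμ.mem_of_isEarliestPair hear
      -- When `p'` is at the head, `q'` is unmatched in `ν` although `(p, q')` is improving.
      -- Stability of `ν` gives `p` a better worker there, to whom `exists_proposer` applies, with
      -- the order not yet shortened.
      by_cases hp' : p' = p₁
      · subst hp'
        obtain rfl := hμ.stable.firm_unique hmem' hmem₁
        obtain ⟨ν, hν, -⟩ := (I.restrict _ (I.improving_subset μ)).exists_isWorkerOptimal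
        have hun := hμ.unmatched_of_isEarliestPair hear hν
        have himp : (p, q') ∈ I.improving μ := ⟨hE, fun c hc => by
          obtain rfl := hμ.stable.worker_unique hmem' hc
          exact hpref⟩
        obtain ⟨q₀, hq₀, rfl | hlt₀⟩ := hν.exists_firm_partner himp fun c hc => absurd hc (hun c)
        · exact absurd hq₀ (hun p)
        obtain ⟨v, hvE, hvq, hle, hv⟩ := exists_proposer _ hμ hk hord hν hmem hq₀
        refine ⟨v, hvE, hvq, ?_, hv⟩
        rcases hle with rfl | hle
        · exact hlt₀
        · exact I.firm_trans p v q₀ q' hvE (hν.subset hq₀).1 hE hle hlt₀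
      have hcard : (μ \ {(p₁, q₁)}).ncard = k := by
        rw [Set.ncard_sdiff_singleton_of_mem hmem₁, hk, Nat.add_sub_cancel]
      have hq' : q' ≠ q₁ := fun h => hp' (hμ.stable.worker_unique (h ▸ hmem') hmem₁)
      rw [List.idxOf_cons_ne _ (Ne.symm hp), List.idxOf_cons_ne _ (Ne.symm hp')] at hlt
      obtain ⟨v, hvE, hvq, hvlt, hv⟩ := ih (hμ.contract hear) hcard hacc
        ⟨hmem, fun h => hp (congrArg Prod.fst h)⟩ ⟨hmem', fun h => hp' (congrArg Prod.fst h)⟩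
        (by omega) ⟨hE, hp, hq'⟩ hpref
      refine ⟨v, hvE.1, hvq, hvlt, fun a ha => ?_⟩
      have ha₁ : a ≠ p₁ := fun h => hvE.2.2 (hμ.stable.firm_unique (h ▸ ha) hmem₁)
      obtain ⟨h₁, h₂⟩ := hv a ⟨ha, fun h => ha₁ (congrArg Prod.fst h)⟩
      refine ⟨h₁, ?_⟩
      rw [List.idxOf_cons_ne _ (Ne.symm hp), List.idxOf_cons_ne _ (Ne.symm ha₁)]
      omega

end AcceptanceOrder


/-! ### Offer lists -/

section OfferList

variable {P Q : Type*} {I : MatchingInstance P Q}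

/-- A duplicate-free list of acceptable offers that is consistent with the preferences of the
firms. -/
structure IsOfferList (I : MatchingInstance P Q) (σ : List (P × Q)) : Prop where
  nodup : σ.Nodup
  subset : ∀ e ∈ σ, e ∈ I.E
  consistent : σ.Pairwise (fun e e' => e.1 = e'.1 → I.firmPref e.1 e.2 e'.2)

/-- Subgames need not offer all acceptable pairs, so the inductions on the game tree use this
hereditary notion instead of `IsOfferingOrder`. -/
theorem IsOfferList.sublist {σ τ : List (P × Q)} (h : I.IsOfferList σ) (hτ : τ.Sublist σ) :
    I.IsOfferList τ :=
  ⟨h.nodup.sublist hτ, fun e he => h.subset e (hτ.subset he), h.consistent.sublist hτ⟩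

theorem IsOfferList.tail {e : P × Q} {σ : List (P × Q)} (h : I.IsOfferList (e :: σ)) :
    I.IsOfferList σ :=
  h.sublist (List.sublist_cons_self _ _)

theorem IsOfferList.notMem {e : P × Q} {σ : List (P × Q)} (h : I.IsOfferList (e :: σ)) : e ∉ σ :=
  (List.nodup_cons.1 h.nodup).1

theorem IsOfferList.head_mem {e : P × Q} {σ : List (P × Q)} (h : I.IsOfferList (e :: σ)) :
    e ∈ I.E :=
  h.subset e List.mem_cons_self

end OfferList

/-! ### Contracted orders and recursion on the game tree -/

section Game

variable {P Q : Type*} [DecidableEq P] [DecidableEq Q] {I : MatchingInstance P Q}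

theorem mem_contractOrder {σ : List (P × Q)} {e e' : P × Q} :
    e' ∈ contractOrder σ e ↔ e' ∈ σ ∧ e'.1 ≠ e.1 ∧ e'.2 ≠ e.2 := by
  simp [contractOrder]

theorem contractOrder_sublist (σ : List (P × Q)) (e : P × Q) :
    (contractOrder σ e).Sublist σ :=
  List.filter_sublist

theorem length_contractOrder_le (σ : List (P × Q)) (e : P × Q) :
    (contractOrder σ e).length ≤ σ.length :=
  List.length_filter_le _ _

/-- Induction along the game tree. -/
theorem order_induction {motive : List (P × Q) → Prop} (nil : motive [])
    (cons : ∀ e σ, motive σ → motive (contractOrder σ e) → motive (e :: σ)) (σ : List (P × Q)) :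
    motive σ := by
  induction hn : σ.length using Nat.strong_induction_on generalizing σ with
  | _ n ih =>
    subst hn
    cases σ with
    | nil => exact nil
    | cons e σ =>
      exact cons e σ (ih _ (Nat.lt_succ_self _) _ rfl)
        (ih _ (Nat.lt_succ_of_le (length_contractOrder_le σ e)) _ rfl)

theorem IsOfferList.contractOrder {e : P × Q} {σ : List (P × Q)} (h : I.IsOfferList (e :: σ)) :
    I.IsOfferList (contractOrder σ e) :=
  h.tail.sublist (contractOrder_sublist _ _)

/-! ### Backward induction -/

open Classical in
/-- The outcome of the game with the given offering order that is found by backward induction. -/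
noncomputable def backwardInduction (I : MatchingInstance P Q) : List (P × Q) → Set (P × Q)
  | [] => ∅
  | e :: σ =>
    if I.WorkerPrefersTo (backwardInduction I σ) e.2 e.1 then
      insert e (backwardInduction I (contractOrder σ e))
    else backwardInduction I σ
termination_by σ => σ.length
decreasing_by
  · exact Nat.lt_succ_self _
  · exact Nat.lt_succ_of_le (length_contractOrder_le σ e)

theorem backwardInduction_nil : I.backwardInduction [] = ∅ := by
  rw [backwardInduction]

theorem backwardInduction_of_accept {e : P × Q} {σ : List (P × Q)}
    (h : I.WorkerPrefersTo (I.backwardInduction σ) e.2 e.1) :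
    I.backwardInduction (e :: σ) = insert e (I.backwardInduction (contractOrder σ e)) := by
  rw [backwardInduction, if_pos h]

theorem backwardInduction_of_reject {e : P × Q} {σ : List (P × Q)}
    (h : ¬ I.WorkerPrefersTo (I.backwardInduction σ) e.2 e.1) :
    I.backwardInduction (e :: σ) = I.backwardInduction σ := by
  rw [backwardInduction, if_neg h]

theorem backwardInduction_cons_cases (I : MatchingInstance P Q) (e : P × Q) (σ : List (P × Q)) :
    (I.WorkerPrefersTo (I.backwardInduction σ) e.2 e.1 ∧
      I.backwardInduction (e :: σ) = insert e (I.backwardInduction (contractOrder σ e))) ∨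
    (¬ I.WorkerPrefersTo (I.backwardInduction σ) e.2 e.1 ∧
      I.backwardInduction (e :: σ) = I.backwardInduction σ) := by
  by_cases h : I.WorkerPrefersTo (I.backwardInduction σ) e.2 e.1
  · exact .inl ⟨h, backwardInduction_of_accept h⟩
  · exact .inr ⟨h, backwardInduction_of_reject h⟩

theorem mem_of_mem_backwardInduction {σ : List (P × Q)} {e : P × Q}
    (h : e ∈ I.backwardInduction σ) : e ∈ σ := by
  induction σ using order_induction with
  | nil => rw [backwardInduction_nil] at h; exact h.elim
  | cons e' σ ih₁ ih₂ =>
    rcases I.backwardInduction_cons_cases e' σ with ⟨-, heq⟩ | ⟨-, heq⟩ <;> rw [heq] at h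
    · rcases h with rfl | h
      · exact List.mem_cons_self
      · exact List.mem_cons_of_mem _ (mem_contractOrder.1 (ih₂ h)).1
    · exact List.mem_cons_of_mem _ (ih₁ h)

theorem ne_of_mem_backwardInduction_contractOrder {σ : List (P × Q)} {e e' : P × Q}
    (h : e' ∈ I.backwardInduction (contractOrder σ e)) : e'.1 ≠ e.1 ∧ e'.2 ≠ e.2 :=
  (mem_contractOrder.1 (mem_of_mem_backwardInduction h)).2

theorem backwardInduction_firm_unique {σ : List (P × Q)} {p : P} {q q' : Q}
    (h : (p, q) ∈ I.backwardInduction σ) (h' : (p, q') ∈ I.backwardInduction σ) : q = q' := by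
  induction σ using order_induction with
  | nil => rw [backwardInduction_nil] at h; exact h.elim
  | cons e σ ih₁ ih₂ =>
    rcases I.backwardInduction_cons_cases e σ with ⟨-, heq⟩ | ⟨-, heq⟩ <;> rw [heq] at h h'
    · rcases h with h | h <;> rcases h' with h' | h'
      · exact (Prod.ext_iff.1 (h.trans h'.symm)).2
      · exact absurd (Prod.ext_iff.1 h).1 (ne_of_mem_backwardInduction_contractOrder h').1
      · exact absurd (Prod.ext_iff.1 h').1 (ne_of_mem_backwardInduction_contractOrder h).1
      · exact ih₂ h h'
    · exact ih₁ h h'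

theorem backwardInduction_worker_unique {σ : List (P × Q)} {p p' : P} {q : Q}
    (h : (p, q) ∈ I.backwardInduction σ) (h' : (p', q) ∈ I.backwardInduction σ) : p = p' := by
  induction σ using order_induction with
  | nil => rw [backwardInduction_nil] at h; exact h.elim
  | cons e σ ih₁ ih₂ =>
    rcases I.backwardInduction_cons_cases e σ with ⟨-, heq⟩ | ⟨-, heq⟩ <;> rw [heq] at h h'
    · rcases h with h | h <;> rcases h' with h' | h'
      · exact (Prod.ext_iff.1 (h.trans h'.symm)).1
      · exact absurd (Prod.ext_iff.1 h).2 (ne_of_mem_backwardInduction_contractOrder h').2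
      · exact absurd (Prod.ext_iff.1 h').2 (ne_of_mem_backwardInduction_contractOrder h).2
      · exact ih₂ h h'
    · exact ih₁ h h'

/-- A worker who rejects an offer obtains something better. -/
theorem IsOfferList.exists_better_of_reject {e : P × Q} {σ : List (P × Q)}
    (hσ : I.IsOfferList (e :: σ)) (h : ¬ I.WorkerPrefersTo (I.backwardInduction σ) e.2 e.1) :
    ∃ p, (p, e.2) ∈ I.backwardInduction σ ∧ I.workerPref e.2 p e.1 := by
  unfold WorkerPrefersTo at h
  push Not at h
  obtain ⟨p, hp, hn⟩ := h
  have hp' := mem_of_mem_backwardInduction hp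
  rcases I.worker_total e.2 e.1 p hσ.head_mem (hσ.tail.subset _ hp') with h | h | h
  · exact absurd h hn
  · exact absurd (show e ∈ σ by rw [show e = (p, e.2) from Prod.ext h rfl]; exact hp') hσ.notMem
  · exact ⟨p, hp, h⟩

/-! ### Subgame perfect equilibria -/

theorem outcome_nil (s : List Action → Action) : outcome s ([] : List (P × Q)) = ∅ := by
  rw [outcome]

theorem outcome_of_accept {s : List Action → Action} {e : P × Q} {σ : List (P × Q)}
    (h : s [] = .accept) :
    outcome s (e :: σ) = insert e (outcome (fun h => s (.accept :: h)) (contractOrder σ e)) := by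
  rw [outcome, h]

theorem outcome_of_reject {s : List Action → Action} {e : P × Q} {σ : List (P × Q)}
    (h : s [] = .reject) : outcome s (e :: σ) = outcome (fun h => s (.reject :: h)) σ := by
  rw [outcome, h]

theorem mem_of_mem_outcome {σ : List (P × Q)} {s : List Action → Action} {e : P × Q}
    (h : e ∈ outcome s σ) : e ∈ σ := by
  induction σ using order_induction generalizing s with
  | nil => rw [outcome_nil] at h; exact h.elim
  | cons e' σ ih₁ ih₂ =>
    cases hs₀ : s []
    · rw [outcome_of_accept hs₀] at h
      rcases h with rfl | h
      · exact List.mem_cons_self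
      · exact List.mem_cons_of_mem _ (mem_contractOrder.1 (ih₂ h)).1
    · rw [outcome_of_reject hs₀] at h
      exact List.mem_cons_of_mem _ (ih₁ h)

theorem subgame_nil_left (h : List Action) : subgame ([] : List (P × Q)) h = [] := by
  cases h <;> rfl

theorem subgame_nil_right (σ : List (P × Q)) : subgame σ [] = σ := by
  cases σ <;> rfl

theorem subgame_append (σ : List (P × Q)) (h h' : List Action) :
    subgame σ (h ++ h') = subgame (subgame σ h) h' := by
  induction h generalizing σ with
  | nil => rw [List.nil_append, subgame_nil_right]
  | cons a h ih =>
    cases σ with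
    | nil => rw [subgame_nil_left, subgame_nil_left, subgame_nil_left]
    | cons e σ =>
      cases a
      · exact ih (contractOrder σ e)
      · exact ih σ

theorem IsOfferList.subgame {σ : List (P × Q)} (hσ : I.IsOfferList σ) (h : List Action) :
    I.IsOfferList (subgame σ h) := by
  induction h generalizing σ with
  | nil => rwa [subgame_nil_right]
  | cons a h ih =>
    cases σ with
    | nil => rwa [subgame_nil_left]
    | cons e σ =>
      cases a
      · exact ih hσ.contractOrder
      · exact ih hσ.tail

theorem moves_nil (e : P × Q) (σ : List (P × Q)) : Moves (e :: σ) [] e.2 :=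
  ⟨e, rfl, rfl⟩

/-- By induction both subgames after the first offer have the backward induction outcome, so only
the first answer is open. Strictness decides it. -/
theorem outcome_eq_of_isSPE {σ : List (P × Q)} (hσ : I.IsOfferList σ)
    {s : List Action → Action} (hs : I.IsSPE σ s) : outcome s σ = I.backwardInduction σ := by
  induction σ using order_induction generalizing s with
  | nil => rw [outcome_nil, backwardInduction_nil]
  | cons e σ ih₁ ih₂ =>
    have hacc := ih₂ hσ.contractOrder (s := fun h => s (.accept :: h)) fun h => hs (.accept :: h)
    have hrej := ih₁ hσ.tail (s := fun h => s (.reject :: h)) fun h => hs (.reject :: h)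
    -- Deviations at the root alone suffice.
    have dev : ∀ a, I.WorkerWeaklyPrefers e.2 (outcome s (e :: σ))
        (outcome (fun h => if h = [] then a else s h) (e :: σ)) := by
      intro a
      refine hs [] e.2 _ fun h hm => ?_
      cases h with
      | nil => exact absurd (moves_nil e σ) hm
      | cons b h => rfl
    cases hs₀ : s []
    · have hd := dev .reject
      rw [outcome_of_accept hs₀, outcome_of_reject (by simp), hacc] at hd
      simp only [List.cons_ne_nil, if_false] at hd
      rw [hrej] at hd
      rw [outcome_of_accept hs₀, hacc, backwardInduction_of_accept]
      intro p hp
      obtain ⟨p₁, h₁, h₁'⟩ := hd p hp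
      have hp₁ : p₁ = e.1 := by
        rcases h₁ with h₁ | h₁
        · exact (Prod.ext_iff.1 h₁).1
        · exact absurd rfl (ne_of_mem_backwardInduction_contractOrder h₁).2
      rcases h₁' with rfl | h₁'
      · subst hp₁
        exact absurd (mem_of_mem_backwardInduction hp) hσ.notMem
      · exact hp₁ ▸ h₁'
    · have hd := dev .accept
      rw [outcome_of_reject hs₀, outcome_of_accept (by simp), hrej] at hd
      rw [outcome_of_reject hs₀, hrej, backwardInduction_of_reject]
      intro hw
      obtain ⟨p₁, h₁, h₁'⟩ := hd e.1 (.inl rfl)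
      have hE₁ := hσ.tail.subset _ (mem_of_mem_backwardInduction h₁)
      have hlt := hw p₁ h₁
      rcases h₁' with rfl | h₁'
      · exact I.worker_irrefl _ _ hE₁ hlt
      · exact I.worker_asymm hσ.head_mem hE₁ hlt h₁'

open Classical in
/-- The strategy profile of backward induction. -/
noncomputable def backwardInductionProfile (I : MatchingInstance P Q) (σ : List (P × Q))
    (h : List Action) : Action :=
  match subgame σ h with
  | [] => .accept
  | e :: τ => if I.WorkerPrefersTo (I.backwardInduction τ) e.2 e.1 then .accept else .reject

theorem backwardInductionProfile_append (σ : List (P × Q)) (h h' : List Action) :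
    I.backwardInductionProfile σ (h ++ h') = I.backwardInductionProfile (subgame σ h) h' := by
  unfold backwardInductionProfile
  rw [subgame_append]

theorem outcome_backwardInductionProfile (σ : List (P × Q)) :
    outcome (I.backwardInductionProfile σ) σ = I.backwardInduction σ := by
  induction σ using order_induction with
  | nil => rw [outcome_nil, backwardInduction_nil]
  | cons e σ ih₁ ih₂ =>
    rcases I.backwardInduction_cons_cases e σ with ⟨hw, heq⟩ | ⟨hw, heq⟩
    · rw [heq, outcome_of_accept (if_pos hw), ← ih₂]
      rfl
    · rw [heq, outcome_of_reject (if_neg hw), ← ih₁]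
      rfl

/-- The induction over subgames covers deviations at many histories at once: after the first answer,
the deviation is again one by the same worker. -/
theorem IsOfferList.isNash_backwardInductionProfile {σ : List (P × Q)} (hσ : I.IsOfferList σ) :
    I.IsNash σ (I.backwardInductionProfile σ) := by
  intro q s' hs'
  rw [outcome_backwardInductionProfile]
  induction σ using order_induction generalizing s' with
  | nil => rw [outcome_nil]; exact fun _ h => h.elim
  | cons e σ ih₁ ih₂ =>
    have hacc := ih₂ hσ.contractOrder (fun h => s' (.accept :: h)) fun h hm => hs' (.accept :: h) hm
    have hrej := ih₁ hσ.tail (fun h => s' (.reject :: h)) fun h hm => hs' (.reject :: h) hm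
    by_cases hq : e.2 = q
    · subst hq
      -- Accepting ends the game for her; rejecting leaves a deviation in the subgame, bounded by
      -- induction.
      have hout : ∀ p₂, (p₂, e.2) ∈ outcome s' (e :: σ) →
          p₂ = e.1 ∨ ∃ p₁, (p₁, e.2) ∈ I.backwardInduction σ ∧
            (p₁ = p₂ ∨ I.workerPref e.2 p₁ p₂) := by
        intro p₂ h₂
        cases hs₀ : s' []
        · rw [outcome_of_accept hs₀] at h₂
          rcases h₂ with h₂ | h₂
          · exact .inl (Prod.ext_iff.1 h₂).1
          · obtain ⟨p₁, h₁, -⟩ := hacc p₂ h₂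
            exact absurd rfl (ne_of_mem_backwardInduction_contractOrder h₁).2
        · rw [outcome_of_reject hs₀] at h₂
          exact .inr (hrej p₂ h₂)
      intro p₂ h₂
      rcases I.backwardInduction_cons_cases e σ with ⟨hw, heq⟩ | ⟨hw, heq⟩ <;> rw [heq]
      · refine ⟨e.1, .inl rfl, ?_⟩
        rcases hout p₂ h₂ with rfl | ⟨p₁, h₁, rfl | h₁'⟩
        · exact .inl rfl
        · exact .inr (hw p₁ h₁)
        · exact .inr (I.worker_trans _ _ _ _ hσ.head_mem
            (hσ.tail.subset _ (mem_of_mem_backwardInduction h₁)) (hσ.subset _ (mem_of_mem_outcome h₂)) (hw p₁ h₁) h₁')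
      · rcases hout p₂ h₂ with rfl | h
        · obtain ⟨p₁, h₁, h₁'⟩ := hσ.exists_better_of_reject hw
          exact ⟨p₁, h₁, .inr h₁'⟩
        · exact h
    · have hs₀ : s' [] = I.backwardInductionProfile (e :: σ) [] := by
        refine hs' [] ?_
        rintro ⟨e', he', hq'⟩
        rw [subgame_nil_right, List.head?_cons, Option.some_inj] at he'
        exact hq (he' ▸ hq')
      intro p₂ h₂
      rcases I.backwardInduction_cons_cases e σ with ⟨hw, heq⟩ | ⟨hw, heq⟩ <;> rw [heq]
      · rw [outcome_of_accept (hs₀.trans (if_pos hw))] at h₂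
        rcases h₂ with h₂ | h₂
        · exact absurd (Prod.ext_iff.1 h₂).2.symm hq
        · obtain ⟨p₁, h₁, h₁'⟩ := hacc p₂ h₂
          exact ⟨p₁, .inr h₁, h₁'⟩
      · rw [outcome_of_reject (hs₀.trans (if_neg hw))] at h₂
        exact hrej p₂ h₂

theorem IsOfferList.isSPE_backwardInductionProfile {σ : List (P × Q)} (hσ : I.IsOfferList σ) :
    I.IsSPE σ (I.backwardInductionProfile σ) := by
  intro h
  have := (hσ.subgame h).isNash_backwardInductionProfile
  rwa [← funext (backwardInductionProfile_append (I := I) σ h)] at this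

theorem IsOfferList.isSPEMatching_iff {σ : List (P × Q)} (hσ : I.IsOfferList σ)
    {M : Set (P × Q)} : I.IsSPEMatching σ M ↔ M = I.backwardInduction σ := by
  constructor
  · rintro ⟨s, hs, rfl⟩
    exact outcome_eq_of_isSPE hσ hs
  · rintro rfl
    exact ⟨_, hσ.isSPE_backwardInductionProfile, outcome_backwardInductionProfile σ⟩

/-! ### Bounds for the outcome of backward induction -/

/-- A worker obtains at least the firm that makes its first offer to her. -/
theorem IsOfferList.exists_weakly_better_of_top {σ : List (P × Q)} (hσ : I.IsOfferList σ) {p : P}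
    {q : Q} (h : (p, q) ∈ σ) (htop : ∀ q', (p, q') ∈ σ → q' = q ∨ I.firmPref p q q') :
    ∃ p', (p', q) ∈ I.backwardInduction σ ∧ (p' = p ∨ I.workerPref q p' p) := by
  induction σ using order_induction with
  | nil => simp at h
  | cons e σ ih₁ ih₂ =>
    have htop' : ∀ q', (p, q') ∈ σ → q' = q ∨ I.firmPref p q q' := fun q' hq' =>
      htop q' (List.mem_cons_of_mem _ hq')
    rcases List.mem_cons.1 h with rfl | hmem
    · rcases I.backwardInduction_cons_cases (p, q) σ with ⟨hw, heq⟩ | ⟨hw, heq⟩ <;> rw [heq]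
      · exact ⟨p, .inl rfl, .inl rfl⟩
      · obtain ⟨p', hp', hlt⟩ := hσ.exists_better_of_reject hw
        exact ⟨p', hp', .inr hlt⟩
    obtain ⟨p₀, q₀⟩ := e
    obtain ⟨p', hp', hle⟩ := ih₁ hσ.tail hmem htop'
    have hE := hσ.tail.subset _ hmem
    have hE' := hσ.tail.subset _ (mem_of_mem_backwardInduction hp')
    rcases I.backwardInduction_cons_cases (p₀, q₀) σ with ⟨hw, heq⟩ | ⟨hw, heq⟩ <;> rw [heq]
    swap
    · exact ⟨p', hp', hle⟩
    by_cases hq : q₀ = q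
    · subst hq
      have hlt : I.workerPref q₀ p₀ p' := hw p' hp'
      refine ⟨p₀, .inl rfl, .inr ?_⟩
      rcases hle with rfl | hle
      · exact hlt
      · exact I.worker_trans _ _ _ _ hσ.head_mem hE' hE hlt hle
    -- An earlier offer by `p` to another worker would contradict that `q` is its best; so the offer
    -- `(p, q)` survives the contraction.
    have hp : p ≠ p₀ := by
      rintro rfl
      have hlt : I.firmPref p q₀ q := (List.pairwise_cons.1 hσ.consistent).1 _ hmem rfl
      rcases htop q₀ List.mem_cons_self with h' | h'
      · exact hq h'
      · exact I.firm_asymm hσ.head_mem hE hlt h'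
    obtain ⟨p', hp', hle⟩ := ih₂ hσ.contractOrder (mem_contractOrder.2 ⟨hmem, hp, Ne.symm hq⟩)
      fun q' hq' => htop' q' (mem_contractOrder.1 hq').1
    exact ⟨p', .inr hp', hle⟩

/-- If the firms make their offers one after another in the order of their ranks, then no offer is
rejected by a worker who gets worse off later. -/
theorem IsOfferList.not_blocks_later {σ : List (P × Q)} (hσ : I.IsOfferList σ) {rank : P → ℕ}
    (hrank : σ.Pairwise (fun e e' => rank e.1 ≤ rank e'.1)) {p : P} {q q₀ : Q} (h : (p, q) ∈ σ)
    (hq₀ : (p, q₀) ∈ I.backwardInduction σ) (hlt : I.firmPref p q q₀)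
    (hw : ∀ p', (p', q) ∈ I.backwardInduction σ → I.workerPref q p p' ∧ rank p < rank p') :
    False := by
  induction σ using order_induction with
  | nil => simp at h
  | cons e σ ih₁ ih₂ =>
    obtain ⟨hrank₀, hrank₁⟩ := List.pairwise_cons.1 hrank
    have hEq₀ := hσ.subset _ (mem_of_mem_backwardInduction hq₀)
    have hE := hσ.subset _ h
    rcases I.backwardInduction_cons_cases e σ with ⟨hw', heq⟩ | ⟨hw', heq⟩ <;>
      rw [heq] at hq₀ hw
    · rcases List.mem_cons.1 h with h | hmem
      · rcases hq₀ with hq₀ | hq₀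
        · obtain rfl := (Prod.ext_iff.1 (h.trans hq₀.symm)).2
          exact I.firm_irrefl p q hE hlt
        · exact (ne_of_mem_backwardInduction_contractOrder hq₀).1 (Prod.ext_iff.1 h).1
      obtain ⟨p₁, q₁⟩ := e
      rcases hq₀ with hq₀ | hq₀
      · cases hq₀
        exact I.firm_asymm hE hEq₀ hlt ((List.pairwise_cons.1 hσ.consistent).1 _ hmem rfl)
      have hp := (ne_of_mem_backwardInduction_contractOrder hq₀).1
      by_cases hq : q = q₁
      · subst hq
        -- Here `q` accepts the firm making the current offer, whose rank is at most that of `p`,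
        -- while her final partner should come strictly later.
        have h₁ := (hw p₁ (.inl rfl)).2
        have h₂ := hrank₀ _ hmem
        exact absurd h₁ (not_lt.2 h₂)
      · exact ih₂ hσ.contractOrder (hrank₁.sublist (contractOrder_sublist _ _))
          (mem_contractOrder.2 ⟨hmem, hp, hq⟩) hq₀ fun p' hp' => hw p' (.inr hp')
    · rcases List.mem_cons.1 h with h | hmem
      · subst h
        exact hw' fun p' hp' => (hw p' hp').1
      · exact ih₁ hσ.tail hrank₁ hmem hq₀ hw

/-- Offers that are not attractive compared with the final outcome are rejected. -/
theorem backwardInduction_append_of_reject {σ₁ σ₂ : List (P × Q)}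
    (h : ∀ e ∈ σ₁, ¬ I.WorkerPrefersTo (I.backwardInduction σ₂) e.2 e.1) :
    I.backwardInduction (σ₁ ++ σ₂) = I.backwardInduction σ₂ := by
  induction σ₁ with
  | nil => rfl
  | cons e σ₁ ih =>
    have ih := ih fun e' he' => h e' (List.mem_cons_of_mem _ he')
    rw [List.cons_append, backwardInduction_of_reject, ih]
    rw [ih]
    exact h e List.mem_cons_self

end Game


/-! ### The two-phase order and its outcome -/

section TwoPhase

variable {P Q : Type*} {I : MatchingInstance P Q}

/-- Deleting the offers that the firms prefer to the worker-optimal stable matching leaves a tight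
instance. -/
theorem IsWorkerOptimal.isTight_delete {μ : Set (P × Q)} (hμ : I.IsWorkerOptimal μ) :
    (I.delete (I.betterOffers μ)).IsTight μ := by
  have hsub : μ ⊆ I.E \ I.betterOffers μ := by
    rintro ⟨p, q⟩ h
    have hE := hμ.1.subset h
    exact ⟨hE, fun hb => I.firm_irrefl p q hE (hb.2 q h)⟩
  have htop : ∀ p q q', (p, q) ∈ μ → (p, q') ∈ I.E \ I.betterOffers μ →
      q' = q ∨ I.firmPref p q q' := by
    rintro p q q' h ⟨hE, hb⟩
    rcases I.firm_total p q' q hE (hμ.1.subset h) with h' | h' | h'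
    · refine absurd ⟨hE, fun q'' hq'' => ?_⟩ hb
      obtain rfl := hμ.1.firm_unique h hq''
      exact h'
    · exact .inl h'
    · exact .inr h'
  refine ⟨⟨⟨hsub, hμ.1.1.2⟩, ?_⟩, ?_, htop⟩
  · rintro p q ⟨hE, hf, hw⟩
    exact hμ.1.2 p q ⟨hE.1, hf, hw⟩
  intro ν hν
  have hνE : ν ⊆ I.E := fun e he => (hν.subset he).1
  -- In the remaining instance `p` cannot do better than `q`, so if `(p, q)` is not in `ν`,
  -- stability forces `q` to have a better firm.
  have hle : ∀ p q, (p, q) ∈ μ → ∃ p', (p', q) ∈ ν ∧ (p' = p ∨ I.workerPref q p' p) := by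
    intro p q h
    by_cases hf : I.FirmPrefersTo ν p q
    · exact hν.exists_worker_partner (hsub h) hf
    unfold FirmPrefersTo at hf
    push Not at hf
    obtain ⟨q', hq', hn⟩ := hf
    rcases htop p q q' h (hν.subset hq') with rfl | h'
    · exact ⟨p, hq', .inl rfl⟩
    · exact absurd h' hn
  -- A deleted pair blocking `ν` would also block `μ`, since by `hle` the workers fare no worse in
  -- `ν`.
  have hst : I.IsStable ν := by
    refine ⟨⟨hνE, hν.1.2⟩, ?_⟩
    rintro p q ⟨hE, hf, hw⟩
    by_cases hb : (p, q) ∈ I.betterOffers μ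
    · refine hμ.1.2 p q ⟨hE, hb.2, fun p' hp' => ?_⟩
      obtain ⟨p₁, h₁, rfl | h₁'⟩ := hle p' q hp'
      · exact hw p₁ h₁
      · exact I.worker_trans q p p₁ p' hE (hνE h₁) (hμ.1.subset hp') (hw p₁ h₁) h₁'
    · exact hν.2 p q ⟨⟨hE, hb⟩, hf, hw⟩
  exact IsWorkerOptimal.unique ⟨hst, fun ν' hν' q p h => by
    obtain ⟨p₁, h₁, hp₁⟩ := hμ.2 ν' hν' q p h
    obtain ⟨p₂, h₂, hp₂⟩ := hle p₁ q h₁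
    refine ⟨p₂, h₂, ?_⟩
    rcases hp₁ with rfl | hp₁
    · exact hp₂
    rcases hp₂ with rfl | hp₂
    · exact .inr hp₁
    · exact .inr (I.worker_trans q p₂ p₁ p (hνE h₂) (hμ.1.subset h₁) (hν'.subset h) hp₂ hp₁)⟩ hμ

/-- Selection sort, with the order axioms required on `s` only because preferences are meaningful
only between acceptable partners. -/
theorem exists_sorted_list {α : Type*} (s : Set α) (hs : s.Finite) (r : α → α → Prop)
    (htrans : ∀ a ∈ s, ∀ b ∈ s, ∀ c ∈ s, r a b → r b c → r a c)
    (htotal : ∀ a ∈ s, ∀ b ∈ s, r a b ∨ a = b ∨ r b a) :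
    ∃ l : List α, (∀ a, a ∈ l ↔ a ∈ s) ∧ l.Nodup ∧ l.Pairwise r := by
  induction hn : s.ncard generalizing s with
  | zero =>
    rw [Set.ncard_eq_zero hs] at hn
    exact ⟨[], by simp [hn], by simp, by simp⟩
  | succ n ih =>
    obtain ⟨m, hm, hmax⟩ := exists_top_of_finite hs r htrans htotal
      (Set.nonempty_of_ncard_ne_zero (by omega))
    obtain ⟨l, hl, hnodup, hpw⟩ := ih (s \ {m}) (hs.subset Set.sdiff_subset)
      (fun a ha b hb c hc => htrans a ha.1 b hb.1 c hc.1)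
      (fun a ha b hb => htotal a ha.1 b hb.1)
      (by rw [Set.ncard_sdiff_singleton_of_mem hm, hn, Nat.add_sub_cancel])
    refine ⟨m :: l, fun a => ?_, List.nodup_cons.2 ⟨fun h => ((hl m).1 h).2 rfl, hnodup⟩,
      List.pairwise_cons.2 ⟨fun a ha => ?_, hpw⟩⟩
    · rw [List.mem_cons, hl]
      by_cases ha : a = m
      · simp [ha, hm]
      · simp [ha]
    · obtain ⟨has, ham⟩ := (hl a).1 ha
      exact (hmax a has).resolve_left ham

theorem pairwise_idxOf_le {α : Type*} [DecidableEq α] {l : List α} (hl : l.Nodup) :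
    l.Pairwise (fun a b => l.idxOf a ≤ l.idxOf b) := by
  rw [List.pairwise_iff_getElem]
  intro i j hi hj hij
  rw [hl.idxOf_getElem i hi, hl.idxOf_getElem j hj]
  exact hij.le

/-- Every set of acceptable offers can be listed such that the firms make their offers one after
another, each in the order of its preferences. -/
theorem exists_isOfferList [Finite Q] [DecidableEq P] {D : Set (P × Q)} (hD : D ⊆ I.E) {π : List P}
    (hπ : π.Nodup) (hmem : ∀ p, p ∈ π) :
    ∃ σ : List (P × Q), (∀ e, e ∈ σ ↔ e ∈ D) ∧ I.IsOfferList σ ∧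
      σ.Pairwise (fun e e' => π.idxOf e.1 ≤ π.idxOf e'.1) := by
  have hex : ∀ p, ∃ l : List Q, (∀ q, q ∈ l ↔ (p, q) ∈ D) ∧ l.Nodup ∧ l.Pairwise (I.firmPref p) :=
    fun p => exists_sorted_list {q | (p, q) ∈ D} (Set.toFinite _) (I.firmPref p)
      (fun a ha b hb c hc => I.firm_trans p a b c (hD ha) (hD hb) (hD hc))
      (fun a ha b hb => I.firm_total p a b (hD ha) (hD hb))
  choose l hl hnodup hpw using hex
  have hfst : ∀ p, ∀ e ∈ (l p).map (Prod.mk p), e.1 = p := by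
    intro p e he
    obtain ⟨q, -, rfl⟩ := List.mem_map.1 he
    rfl
  have hmem' : ∀ e, e ∈ π.flatMap (fun p => (l p).map (Prod.mk p)) ↔ e ∈ D := by
    rintro ⟨p, q⟩
    rw [List.mem_flatMap]
    constructor
    · rintro ⟨p', -, he⟩
      obtain ⟨q', hq', heq⟩ := List.mem_map.1 he
      cases heq
      exact (hl _ _).1 hq'
    · exact fun h => ⟨p, hmem p, List.mem_map.2 ⟨q, (hl _ _).2 h, rfl⟩⟩
  refine ⟨π.flatMap fun p => (l p).map (Prod.mk p), hmem', ⟨?_, fun e he => hD ((hmem' e).1 he), ?_⟩,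
    ?_⟩
  · refine List.pairwise_flatMap.2 ⟨fun p _ => (hnodup p).map (Prod.mk_right_injective p), ?_⟩
    refine hπ.imp fun hne e he e' he' heq => hne ?_
    rw [← hfst _ e he, heq, hfst _ e' he']
  · refine List.pairwise_flatMap.2 ⟨fun p _ => ?_, ?_⟩
    · exact List.pairwise_map.2 ((hpw p).imp (fun {_ _} h (_ : p = p) => h))
    · refine hπ.imp fun hne e he e' he' heq => absurd ?_ hne
      rw [← hfst _ e he, heq, hfst _ e' he']
  · refine List.pairwise_flatMap.2 ⟨fun p _ => ?_, ?_⟩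
    · exact List.pairwise_map.2 (List.pairwise_of_forall fun _ _ => le_rfl)
    · refine (pairwise_idxOf_le hπ).imp fun hle e he e' he' => ?_
      rwa [hfst _ e he, hfst _ e' he']

/-- A firm unmatched in `μ` loses all its pairs, so only matched firms make offers in the second
phase. -/
theorem exists_mem_of_mem_delete_betterOffers {μ : Set (P × Q)} {p : P} {q : Q}
    (h : (p, q) ∈ (I.delete (I.betterOffers μ)).E) :
    ∃ q', (p, q') ∈ μ ∧ ¬ I.firmPref p q q' := by
  by_contra! hcon
  exact h.2 ⟨h.1, hcon⟩

theorem IsWorkerOptimal.exists_isTwoPhaseOrder [Finite P] [Finite Q] [DecidableEq P] {μ : Set (P × Q)}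
    (hμ : I.IsWorkerOptimal μ) : ∃ σ : List (P × Q), I.IsTwoPhaseOrder μ σ := by
  classical
  have hT := hμ.isTight_delete
  obtain ⟨π₀, hπ₀, -, hacc⟩ := IsTight.exists_isAcceptanceOrder μ.ncard hT rfl
  have := Fintype.ofFinite P
  set π := π₀ ++ (Finset.univ.filter (· ∉ π₀)).toList with hπdef
  have hπ : π.Nodup := List.nodup_append'.2 ⟨hπ₀, Finset.nodup_toList _, fun p h h' => by
    simp [h] at h'⟩
  have hmem : ∀ p, p ∈ π := fun p => by
    by_cases h : p ∈ π₀ <;> simp [hπdef, h]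
  obtain ⟨σ₁, hσ₁, hl₁, -⟩ := exists_isOfferList (I := I) (D := I.betterOffers μ)
    (fun _ h => h.1) hπ hmem
  obtain ⟨σ₂, hσ₂, hl₂, hrank⟩ := exists_isOfferList (I := I)
    (D := I.E \ I.betterOffers μ) (fun _ h => h.1) hπ hmem
  refine ⟨σ₁ ++ σ₂, ⟨?_, fun e => ?_, ?_⟩, σ₁, σ₂, π, rfl, hσ₁, hπ, hmem, hrank, μ,
    hT.isWorkerOptimal, hacc _⟩
  · exact List.nodup_append'.2 ⟨hl₁.nodup, hl₂.nodup, fun e h h' =>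
      ((hσ₂ e).1 h').2 ((hσ₁ e).1 h)⟩
  · rw [List.mem_append, hσ₁, hσ₂]
    constructor
    · rintro (h | h)
      · exact h.1
      · exact h.1
    · exact fun h => or_iff_not_imp_left.2 fun h' => ⟨h, h'⟩
  · refine List.pairwise_append.2 ⟨hl₁.consistent, hl₂.consistent, ?_⟩
    -- Across the phases, the stable partner of the firm separates the two offers.
    rintro ⟨p, q⟩ h ⟨p', q'⟩ h' (rfl : p = p')
    have hb := (hσ₁ _).1 h
    have hd := (hσ₂ _).1 h'
    obtain ⟨q₁, hq₁, hn⟩ := exists_mem_of_mem_delete_betterOffers hd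
    have hlt : I.firmPref p q q₁ := hb.2 q₁ hq₁
    rcases I.firm_total p q' q₁ hd.1 (hμ.1.subset hq₁) with h | rfl | h
    · exact absurd h hn
    · exact hlt
    · exact I.firm_trans p q q₁ q' hb.1 (hμ.1.subset hq₁) hd.1 hlt h

variable [DecidableEq P] [DecidableEq Q]

theorem backwardInduction_delete (D : Set (P × Q)) (σ : List (P × Q)) :
    (I.delete D).backwardInduction σ = I.backwardInduction σ := by
  induction σ using order_induction with
  | nil => rw [backwardInduction_nil, backwardInduction_nil]
  | cons e σ ih₁ ih₂ =>
    rcases I.backwardInduction_cons_cases e σ with ⟨hw, heq⟩ | ⟨hw, heq⟩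
    · rw [heq, backwardInduction_of_accept (by rw [ih₁]; exact hw), ih₂]
    · rw [heq, backwardInduction_of_reject (by rw [ih₁]; exact hw), ih₁]

/-- If the firms of a tight instance make their offers one after another along an acceptance order,
then backward induction finds the stable matching. -/
theorem IsTight.backwardInduction_eq [Finite P] [Finite Q] {μ : Set (P × Q)} (hμ : I.IsTight μ)
    (hfirm : ∀ p q, (p, q) ∈ I.E → ∃ q', (p, q') ∈ μ) {σ : List (P × Q)} (hσ : I.IsOfferList σ)
    (hmem : ∀ e, e ∈ σ ↔ e ∈ I.E) {π : List P} (hπ : ∀ p, p ∈ π)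
    (hrank : σ.Pairwise (fun e e' => π.idxOf e.1 ≤ π.idxOf e'.1))
    (hacc : IsAcceptanceOrder μ.ncard I π) : I.backwardInduction σ = μ := by
  set M := I.backwardInduction σ with hM
  have hME : M ⊆ I.E := fun e he => (hmem e).1 (mem_of_mem_backwardInduction he)
  have hbest : ∀ p q, (p, q) ∈ μ → ∃ p', (p', q) ∈ M ∧ (p' = p ∨ I.workerPref q p' p) :=
    fun p q h => hσ.exists_weakly_better_of_top ((hmem _).2 (hμ.stable.subset h)) fun q' hq' =>
      hμ.top p q q' h ((hmem _).1 hq')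
  have hinj : ∀ {p p'}, π.idxOf p = π.idxOf p' → p = p' := fun h => (List.idxOf_inj (hπ _)).1 h
  -- Send a pair of `μ` to the pair of `μ` whose firm its worker obtains in `M`. This self-map of a
  -- finite set is injective, hence onto.
  have hsurj : ∀ p q, (p, q) ∈ μ → ∃ a b, (a, b) ∈ μ ∧ (p, b) ∈ M := by
    have hex : ∀ e : μ, ∃ e' : μ, (e'.1.1, e.1.2) ∈ M := by
      rintro ⟨⟨p, q⟩, h⟩
      obtain ⟨p', hp', -⟩ := hbest p q h
      obtain ⟨q', hq'⟩ := hfirm p' q (hME hp')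
      exact ⟨⟨(p', q'), hq'⟩, hp'⟩
    choose f hf using hex
    have hfinj : Function.Injective f := by
      rintro ⟨⟨a, b⟩, hab⟩ ⟨⟨c, d⟩, hcd⟩ heq
      have h₁ := hf ⟨(a, b), hab⟩
      have h₂ := hf ⟨(c, d), hcd⟩
      rw [heq] at h₁
      obtain rfl : b = d := backwardInduction_firm_unique h₁ h₂
      obtain rfl := hμ.stable.worker_unique hab hcd
      rfl
    intro p q h
    obtain ⟨⟨⟨a, b⟩, hab⟩, heq⟩ := Finite.injective_iff_surjective.1 hfinj ⟨(p, q), h⟩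
    have h₁ := hf ⟨(a, b), hab⟩
    rw [heq] at h₁
    exact ⟨a, b, hab, h₁⟩
  have hperf : ∀ p q, (p, q) ∈ M → ∃ p', (p', q) ∈ μ := by
    intro p q h
    obtain ⟨q', hq'⟩ := hfirm p q (hME h)
    obtain ⟨a, b, hab, hb⟩ := hsurj p q' hq'
    exact ⟨a, backwardInduction_firm_unique hb h ▸ hab⟩
  have hsub : μ ⊆ M := by
    by_contra hcon
    -- The last firm that misses its partner: all matched firms after it agree in `M` and `μ`.
    obtain ⟨⟨p, q⟩, ⟨hpq, hpqM⟩, hmax⟩ := Set.exists_max_image (μ \ M) (fun e => π.idxOf e.1)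
      (Set.toFinite _) (Set.sdiff_nonempty.2 hcon)
    obtain ⟨a, b, hab, hpb⟩ := hsurj p q hpq
    have hap : a ≠ p := by
      rintro rfl
      exact hpqM (hμ.stable.firm_unique hab hpq ▸ hpb)
    have habM : (a, b) ∉ M := fun h => hap (backwardInduction_worker_unique h hpb)
    have hpref : I.workerPref b p a := by
      obtain ⟨p', hp', hle⟩ := hbest a b hab
      obtain rfl := backwardInduction_worker_unique hp' hpb
      exact hle.resolve_left (Ne.symm hap)
    have hlt : π.idxOf a < π.idxOf p :=
      lt_of_le_of_ne (hmax (a, b) ⟨hab, habM⟩) fun h => hap (hinj h)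
    obtain ⟨v, hvE, hvq, hvb, hv⟩ := IsAcceptanceOrder.exists_better_proposer π hμ rfl hacc hpq hab
      hlt (hME hpb) hpref
    refine hσ.not_blocks_later (rank := fun p => π.idxOf p) hrank ((hmem _).2 hvE) hpb hvb fun p' hp' => ?_
    obtain ⟨c, hc⟩ := hperf p' v hp'
    have hcp : c ≠ p := by
      rintro rfl
      exact hvq (hμ.stable.firm_unique hc hpq)
    obtain ⟨h₁, h₂⟩ := hv c hc
    have hlt' : π.idxOf p < π.idxOf c := lt_of_le_of_ne h₂ fun h => hcp (hinj h).symm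
    have hcM : (c, v) ∈ M := by
      by_contra hcM
      exact absurd (hmax (c, v) ⟨hc, hcM⟩) (not_le.2 hlt')
    obtain rfl := backwardInduction_worker_unique hp' hcM
    exact ⟨h₁, hlt'⟩
  refine Set.Subset.antisymm ?_ hsub
  rintro ⟨p, q⟩ h
  obtain ⟨q', hq'⟩ := hfirm p q (hME h)
  exact backwardInduction_firm_unique (hsub hq') h ▸ hq'

/-- The second phase is a game on a tight instance and yields `μ`; a worker accepting an offer of
the first phase would then form a blocking pair of `μ`. -/
theorem IsWorkerOptimal.backwardInduction_eq [Finite P] [Finite Q] {μ : Set (P × Q)}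
    (hμ : I.IsWorkerOptimal μ) {σ : List (P × Q)} (hσ : I.IsTwoPhaseOrder μ σ) :
    I.backwardInduction σ = μ := by
  obtain ⟨⟨hnodup, hmem, hcons⟩, σ₁, σ₂, π, rfl, hσ₁, -, hπ, hrank, μ', hμ', hacc⟩ := hσ
  have hT := hμ.isTight_delete
  obtain rfl := hT.eq_of_stable μ' hμ'.1
  have hdisj := (List.nodup_append'.1 hnodup).2.2
  have hσ₂ : ∀ e, e ∈ σ₂ ↔ e ∈ (I.delete (I.betterOffers μ')).E := by
    intro e
    constructor
    · exact fun h => ⟨(hmem e).1 (List.mem_append_right _ h), fun h' => hdisj ((hσ₁ e).2 h') h⟩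
    · rintro ⟨h, h'⟩
      exact (List.mem_append.1 ((hmem e).2 h)).resolve_left fun h₁ => h' ((hσ₁ e).1 h₁)
  have h₂ : I.backwardInduction σ₂ = μ' := by
    rw [← backwardInduction_delete (I.betterOffers μ')]
    refine hT.backwardInduction_eq (fun p q h => ?_)
      ⟨(List.nodup_append'.1 hnodup).2.1, fun e he => (hσ₂ e).1 he,
        (List.pairwise_append.1 hcons).2.1⟩ hσ₂ hπ hrank hacc
    obtain ⟨q', hq', -⟩ := exists_mem_of_mem_delete_betterOffers h
    exact ⟨q', hq'⟩
  rw [backwardInduction_append_of_reject, h₂]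
  rw [h₂]
  exact fun e he hw => hμ.1.2 e.1 e.2 ⟨((hσ₁ e).1 he).1, ((hσ₁ e).1 he).2, hw⟩

end TwoPhase

end MatchingInstance

theorem theorem2 {P Q : Type*} [Finite P] [Finite Q] [DecidableEq P] [DecidableEq Q]
    (I : MatchingInstance P Q) :
    ∃ μ : Set (P × Q), I.IsWorkerOptimal μ ∧
      (∃ σ : List (P × Q), I.IsTwoPhaseOrder μ σ) ∧
      ∀ σ : List (P × Q), I.IsTwoPhaseOrder μ σ →
        ∀ M : Set (P × Q), I.IsSPEMatching σ M ↔ M = μ := by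
  obtain ⟨μ, hμ⟩ := I.exists_isWorkerOptimal
  refine ⟨μ, hμ, hμ.exists_isTwoPhaseOrder, fun σ hσ M => ?_⟩
  have hl : I.IsOfferList σ := ⟨hσ.1.1, fun e he => (hσ.1.2.1 e).1 he, hσ.1.2.2⟩
  rw [hl.isSPEMatching_iff, hμ.backwardInduction_eq hσ]
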